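/- Let $H$ be a separable complex Hilbert space and let $\Sigma(t)=\Sigma(t)^*$, $t\in\mathbb R$, be a nondecreasing, strongly left continuous function with values in $B(H)$. It determines an operator measure $\Delta\mapsto\Sigma(\Delta)$ on the bounded Borel sets of $\mathbb R$, with $\Sigma([a,b))=\Sigma(b)-\Sigma(a)$. Let $C_{00}(H)$ be the space of continuous compactly supported functions $f:\mathbb R\to H$ with values in a finite-dimensional subspace of $H$ (depending on $f$), and let $L_2(\Sigma,H)$ be the Hilbert space obtained from $C_{00}(H)$ with the semidefinite inner product $(f,g)=\int_{\mathbb R}(d\Sigma(t)f(t),g(t))_H$ (limit of Riemann sums) by factoring out the null vectors and completing. Let $\rho$ be a ($\sigma$-finite) Borel measure on $\mathbb R$ equivalent to $\Sigma$, that is, $\rho(\Delta)=0\iff\Sigma(\Delta)=0$ for bounded Borel sets $\Delta$. **Theorem 1.** Let $T$ be a Hilbert–Schmidt operator in $H$ with $\ker T=\ker T^*=\{0\}$. Then the operator measure $\Delta\mapsto T^*\Sigma(\Delta)T$ has a weak density $\Psi(t)\ge 0$ with respect to $\rho$, i.e. $(T^*\Sigma(\Delta)Tx,y)=\int_\Delta(\Psi(t)x,y)\,d\rho(t)$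 for all $x,y\in H$ and all bounded Borel $\Delta$. It is unique up to equality $\rho$-a.e., and its values are trace class operators for $\rho$-a.e. $t$. Let $\mathfrak H_t$ be the Hilbert space obtained from $\mathcal D(T^{-1})=\operatorname{ran}T$ with the seminorm $\|h\|_t=\|\Psi(t)^{1/2}T^{-1}h\|$ by completing and factoring out the vectors of norm zero. Let $\mathfrak H=\int_{\mathbb R}^{\oplus}\mathfrak H_t\,d\rho(t)$ be the direct integral whose measurable structure is given by the constant sections $t\mapsto h$, $h\in\mathcal D(T^{-1})$. 1. The classes of the functions $f\in C_{00}(H)$ with $f(t)\in\mathcal D(T^{-1})$ for all $t$ form a dense subset of $L_2(\Sigma,H)$, and for every such $f$ $$\|f\|^2_{L_2(\Sigma,H)}=\int_{\mathbb R}\|\Psi(t)^{1/2}T^{-1}f(t)\|^2\,d\rho(t)<\infty .$$ 2. $L_2(\Sigma,H)$ coincides isometrically with $\mathfrak H$: there is a unique linear isometry $U$ of $L_2(\Sigma,H)$ onto $\mathfrak H$ that takes every $f$ as in 1 to the section $t\mapsto f(t)\in\mathfrak H_t$. 3. $\mathfrak H$ does not depend on the choice of $T$: if $T_1,T_2$ are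 two such operators, with densities $\Psi_1,\Psi_2$, direct integrals $\mathfrak H^{(1)},\mathfrak H^{(2)}$ and canonical isometries $U_1,U_2$ as in 2, then there is a linear isometry $V$ of $\mathfrak H^{(1)}$ onto $\mathfrak H^{(2)}$ with $VU_1=U_2$. -/

import Mathlib

noncomputable section

open MeasureTheory Filter Topology Set
open scoped InnerProductSpace ENNReal

namespace OpMeasure

/-- A distribution function of an operator measure on `ℝ`: a selfadjoint, nondecreasing (in the
Loewner order), strongly left continuous function with values in the bounded operators on `H`. -/
structure Distribution (H : Type*) [NormedAddCommGroup H] [InnerProductSpace ℂ H]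
    [CompleteSpace H] where
  /-- the operator-valued function `t ↦ Σ(t)` -/
  toFun : ℝ → H →L[ℂ] H
  selfAdjoint : ∀ t, IsSelfAdjoint (toFun t)
  mono : Monotone toFun
  left_cont : ∀ t x, ContinuousWithinAt (fun s => toFun s x) (Iic t) t

variable {H : Type*} [NormedAddCommGroup H] [InnerProductSpace ℂ H] [CompleteSpace H]

namespace Distribution

variable (S : Distribution H)

/-- The increment `Σ(b) - Σ(a)`. -/
def incr (a b : ℝ) : H →L[ℂ] H := S.toFun b - S.toFun a

/-- The scalar distribution function `t ↦ (Σ(t)x, x)`. -/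
def quad (x : H) (t : ℝ) : ℝ := (⟪x, S.toFun t x⟫_ℂ).re

lemma incr_isPositive {a b : ℝ} (h : a ≤ b) : (S.incr a b).IsPositive :=
  (ContinuousLinearMap.le_def _ _).1 (S.mono h)

lemma quad_mono (x : H) : Monotone (S.quad x) := by
  intro a b h
  have := (S.incr_isPositive h).re_inner_nonneg_right x
  simp only [incr, _root_.sub_apply, inner_sub_right] at this
  simpa [quad] using this

lemma inner_incr {a b : ℝ} (h : a ≤ b) (x : H) :
    ⟪x, S.incr a b x⟫_ℂ = ((S.quad x b - S.quad x a : ℝ) : ℂ) := by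
  have h1 := (S.incr_isPositive h).inner_nonneg_right x
  have h2 : ((⟪x, S.incr a b x⟫_ℂ).re : ℂ) = ⟪x, S.incr a b x⟫_ℂ := by
    apply Complex.ext <;> simp [(Complex.le_def.1 h1).2.symm]
  rw [← h2]
  simp [incr, quad]

/-- The scalar measure `Δ ↦ (Σ(Δ)x, x)`: the Lebesgue-Stieltjes measure with
`μ_x([a,b)) = (Σ(b)x, x) - (Σ(a)x, x)`. -/
def scalarMeasure (x : H) : Measure ℝ := (S.quad_mono x).stieltjesFunction.measure

instance instLocallyFinite (x : H) : IsLocallyFiniteMeasure (S.scalarMeasure x) :=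
  inferInstanceAs (IsLocallyFiniteMeasure (S.quad_mono x).stieltjesFunction.measure)

lemma quad_leftLim (x : H) (t : ℝ) : Function.leftLim (S.quad x) t = S.quad x t := by
  have : ContinuousWithinAt (S.quad x) (Iic t) t := by
    unfold quad
    exact Complex.continuous_re.continuousAt.comp_continuousWithinAt
      (continuousWithinAt_const.inner (𝕜 := ℂ) (S.left_cont t x))
  exact this.leftLim_eq

lemma scalarMeasure_Ico (x : H) (a b : ℝ) :
    S.scalarMeasure x (Ico a b) = ENNReal.ofReal (S.quad x b - S.quad x a) := by
  have h : ∀ t, Function.leftLim (Function.rightLim (S.quad x)) t = S.quad x t := by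
    intro t
    have : (𝓝[<] t).NeBot := nhdsLT_neBot t
    exact (leftLim_rightLim ((S.quad_mono x).tendsto_leftLim t)).trans (S.quad_leftLim x t)
  unfold scalarMeasure
  rw [StieltjesFunction.measure_Ico]
  · erw [h a, h b]

lemma scalarMeasure_Ico_real (x : H) {a b : ℝ} (h : a ≤ b) :
    (S.scalarMeasure x).real (Ico a b) = S.quad x b - S.quad x a := by
  rw [Measure.real, scalarMeasure_Ico, ENNReal.toReal_ofReal (sub_nonneg.2 (S.quad_mono x h))]

lemma scalarMeasure_Ico_inner (x : H) {a b : ℝ} (h : a ≤ b) :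
    (((S.scalarMeasure x).real (Ico a b) : ℝ) : ℂ) = ⟪x, S.incr a b x⟫_ℂ := by
  rw [S.scalarMeasure_Ico_real x h, S.inner_incr h]

lemma scalarMeasure_ne_top (x : H) {Δ : Set ℝ} (hb : Bornology.IsBounded Δ) :
    S.scalarMeasure x Δ ≠ ∞ := by
  exact hb.measure_lt_top.ne

/-- Linear relations between the numbers `(Av, v)` valid for all increments pass to the scalar
measures of bounded Borel sets. -/
lemma sum_scalarMeasure {ι : Type} [Fintype ι] (c : ι → ℂ) (v : ι → H)
    (h : ∀ A : H →L[ℂ] H, ∑ j, c j * ⟪v j, A (v j)⟫_ℂ = 0) {Δ : Set ℝ}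
    (hm : MeasurableSet Δ) (hb : Bornology.IsBounded Δ) :
    ∑ j, c j * ((S.scalarMeasure (v j)).real Δ : ℂ) = 0 := by
  obtain ⟨R, hR0, hR⟩ := hb.subset_ball_lt 0 0
  have hsub : Δ ⊆ Ico (-R) R := by
    intro x hx
    have := hR hx
    rw [Real.ball_eq_Ioo] at this
    exact ⟨by linarith [this.1], by linarith [this.2]⟩
  set ν : ι → Measure ℝ := fun j => (S.scalarMeasure (v j)).restrict (Ico (-R) R) with hν
  have : ∀ j, IsFiniteMeasure (ν j) := fun j =>
    ⟨by simpa [hν] using (S.scalarMeasure_ne_top (v j) (Metric.isBounded_Ico (-R) R)).lt_top⟩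
  have hIco : ∀ a b : ℝ, ∑ j, c j * ((ν j).real (Ico a b) : ℂ) = 0 := by
    intro a b
    have : ∀ j, (ν j).real (Ico a b)
        = (S.scalarMeasure (v j)).real (Ico (max a (-R)) (min b R)) := by
      intro j
      rw [hν, measureReal_restrict_apply measurableSet_Ico, Ico_inter_Ico]
    simp_rw [this]
    rcases le_total (max a (-R)) (min b R) with hle | hle
    · simp_rw [S.scalarMeasure_Ico_inner _ hle]
      exact h _
    · simp [Ico_eq_empty_of_le hle]
  have key : ∀ s : Set ℝ, MeasurableSet s → ∑ j, c j * ((ν j).real s : ℂ) = 0 := by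
    intro s hs
    refine MeasurableSpace.induction_on_inter
      (C := fun s _ => ∑ j, c j * ((ν j).real s : ℂ) = 0)
      (borel_eq_generateFrom_Ico ℝ) (isPiSystem_Ico id id) ?_ ?_ ?_ ?_ s
      (by simpa using hs)
    · simp
    · rintro _ ⟨a, b, -, rfl⟩
      exact hIco a b
    · intro t ht hz
      have ht' : MeasurableSet t := by simpa using ht
      have hu : ∑ j, c j * ((ν j).real univ : ℂ) = 0 := by
        have := hIco (-R) R
        simpa [hν, measureReal_restrict_apply] using this
      simp_rw [measureReal_compl ht', Complex.ofReal_sub, mul_sub, Finset.sum_sub_distrib, hz, hu]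
      simp
    · intro f hd hf hz
      have hf' : ∀ i, MeasurableSet (f i) := fun i => by simpa using hf i
      have hs : ∀ j, HasSum (fun i => c j * ((ν j).real (f i) : ℂ))
          (c j * ((ν j).real (⋃ i, f i) : ℂ)) := by
        intro j
        apply HasSum.mul_left
        rw [Complex.hasSum_ofReal]
        have h1 : ν j (⋃ i, f i) = ∑' i, ν j (f i) := measure_iUnion hd hf'
        have h2 : (∑' i, ν j (f i)) ≠ ∞ := h1 ▸ measure_ne_top _ _
        rw [Measure.real, h1, ENNReal.tsum_toReal_eq fun i => measure_ne_top _ _]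
        exact ENNReal.hasSum_toReal h2
      have := hasSum_sum (s := Finset.univ) fun j _ => hs j
      simp_rw [hz] at this
      exact this.unique hasSum_zero
  have := key Δ hm
  simpa [hν, measureReal_restrict_apply hm, inter_eq_self_of_subset_left hsub] using this

/-- Polarization of the scalar measure of `Δ`. -/
def polar (Δ : Set ℝ) (x y : H) : ℂ :=
  ∑ k : Fin 4, (![1, -1, -Complex.I, Complex.I] k / 4) *
    ((S.scalarMeasure (![x + y, x - y, x + Complex.I • y, x - Complex.I • y] k)).real Δ : ℂ)

lemma inner_polarization (A : H →L[ℂ] H) (x y : H) :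
    ∑ k : Fin 4, (![1, -1, -Complex.I, Complex.I] k / 4) *
      ⟪![x + y, x - y, x + Complex.I • y, x - Complex.I • y] k,
        A (![x + y, x - y, x + Complex.I • y, x - Complex.I • y] k)⟫_ℂ = ⟪x, A y⟫_ℂ := by
  simp only [Fin.sum_univ_four, Matrix.cons_val]
  simp only [map_add, map_sub, inner_add_left, inner_add_right, map_smul, inner_smul_left,
    inner_smul_right, Complex.conj_I, inner_sub_left, inner_sub_right]
  linear_combination (-(1/2 : ℂ) * ⟪x, A y⟫_ℂ + (1/2 : ℂ) * ⟪y, A x⟫_ℂ) * Complex.I_sq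

lemma sum_polar {ι : Type} [Fintype ι] (c : ι → ℂ) (x y : ι → H)
    (h : ∀ A : H →L[ℂ] H, ∑ j, c j * ⟪x j, A (y j)⟫_ℂ = 0) {Δ : Set ℝ}
    (hm : MeasurableSet Δ) (hb : Bornology.IsBounded Δ) :
    ∑ j, c j * S.polar Δ (x j) (y j) = 0 := by
  have := S.sum_scalarMeasure (ι := ι × Fin 4)
    (fun p => c p.1 * (![1, -1, -Complex.I, Complex.I] p.2 / 4))
    (fun p => ![x p.1 + y p.1, x p.1 - y p.1, x p.1 + Complex.I • y p.1,
      x p.1 - Complex.I • y p.1] p.2) (fun A => by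
        rw [Fintype.sum_prod_type]
        simp_rw [mul_assoc, ← Finset.mul_sum]
        simp_rw [inner_polarization]
        exact h A) hm hb
  rw [Fintype.sum_prod_type] at this
  simp_rw [mul_assoc, ← Finset.mul_sum] at this
  exact this

lemma polar_self (x : H) {Δ : Set ℝ} (hm : MeasurableSet Δ) (hb : Bornology.IsBounded Δ) :
    S.polar Δ x x = ((S.scalarMeasure x).real Δ : ℂ) := by
  have := S.sum_scalarMeasure (ι := Option (Fin 4))
    (fun p => p.elim (-1) (fun k => ![1, -1, -Complex.I, Complex.I] k / 4))
    (fun p => p.elim x (fun k => ![x + x, x - x, x + Complex.I • x, x - Complex.I • x] k))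
    (fun A => by
      rw [Fintype.sum_option]
      simp only [Option.elim]
      rw [inner_polarization]
      ring) hm hb
  rw [Fintype.sum_option] at this
  simp only [Option.elim] at this
  unfold polar
  linear_combination this

lemma exists_scalarMeasure_le {Δ : Set ℝ} (hb : Bornology.IsBounded Δ) :
    ∃ C, 0 ≤ C ∧ ∀ x, (S.scalarMeasure x).real Δ ≤ C * ‖x‖ ^ 2 := by
  obtain ⟨R, hR0, hR⟩ := hb.subset_ball_lt 0 0
  have hsub : Δ ⊆ Ico (-R) R := by
    intro x hx
    have := hR hx
    rw [Real.ball_eq_Ioo] at this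
    exact ⟨by linarith [this.1], by linarith [this.2]⟩
  refine ⟨‖S.incr (-R) R‖, norm_nonneg _, fun x => ?_⟩
  have h1 : (S.scalarMeasure x).real Δ ≤ (S.scalarMeasure x).real (Ico (-R) R) :=
    measureReal_mono hsub (S.scalarMeasure_ne_top x (Metric.isBounded_Ico _ _))
  have h2 := S.scalarMeasure_Ico_inner x (a := -R) (b := R) (by linarith)
  have h3 : (S.scalarMeasure x).real (Ico (-R) R) ≤ ‖⟪x, S.incr (-R) R x⟫_ℂ‖ := by
    rw [← h2, Complex.norm_real]; exact le_abs_self _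
  have h4 : ‖⟪x, S.incr (-R) R x⟫_ℂ‖ ≤ ‖x‖ * (‖S.incr (-R) R‖ * ‖x‖) :=
    (norm_inner_le_norm _ _).trans (by gcongr; exact ContinuousLinearMap.le_opNorm _ _)
  nlinarith

lemma polar_add_right {Δ : Set ℝ} (hm : MeasurableSet Δ) (hb : Bornology.IsBounded Δ)
    (x y z : H) : S.polar Δ x (y + z) = S.polar Δ x y + S.polar Δ x z := by
  have := S.sum_polar ![1, -1, -1] ![x, x, x] ![y + z, y, z] (fun A => by
    simp [Fin.sum_univ_three]) hm hb
  simp [Fin.sum_univ_three] at this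
  linear_combination this

lemma polar_add_left {Δ : Set ℝ} (hm : MeasurableSet Δ) (hb : Bornology.IsBounded Δ)
    (x y z : H) : S.polar Δ (x + y) z = S.polar Δ x z + S.polar Δ y z := by
  have := S.sum_polar ![1, -1, -1] ![x + y, x, y] ![z, z, z] (fun A => by
    simp [Fin.sum_univ_three]) hm hb
  simp [Fin.sum_univ_three] at this
  linear_combination this

lemma polar_smul_right {Δ : Set ℝ} (hm : MeasurableSet Δ) (hb : Bornology.IsBounded Δ)
    (c : ℂ) (x y : H) : S.polar Δ x (c • y) = c * S.polar Δ x y := by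
  have := S.sum_polar ![1, -c] ![x, x] ![c • y, y] (fun A => by
    simp) hm hb
  simp at this
  linear_combination this

lemma polar_smul_left {Δ : Set ℝ} (hm : MeasurableSet Δ) (hb : Bornology.IsBounded Δ)
    (c : ℂ) (x y : H) : S.polar Δ (c • x) y = (starRingEnd ℂ) c * S.polar Δ x y := by
  have := S.sum_polar ![1, -(starRingEnd ℂ) c] ![c • x, x] ![y, y] (fun A => by
    simp; ring) hm hb
  simp at this
  linear_combination this

lemma exists_norm_polar_le {Δ : Set ℝ} (hm : MeasurableSet Δ) (hb : Bornology.IsBounded Δ) :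
    ∃ C, ∀ x y, ‖S.polar Δ x y‖ ≤ C * ‖x‖ * ‖y‖ := by
  obtain ⟨C, hC0, hC⟩ := S.exists_scalarMeasure_le hb
  have hbd : ∀ x y : H, ‖x‖ = 1 → ‖y‖ = 1 → ‖S.polar Δ x y‖ ≤ 4 * C := by
    intro x y hx hy
    have hv : ∀ v : H, ‖v‖ ≤ 2 → (S.scalarMeasure v).real Δ ≤ 4 * C := fun v hv => by
      have := hC v
      have h2 : ‖v‖ ^ 2 ≤ 4 := by nlinarith [norm_nonneg v]
      nlinarith
    have hIy : ‖Complex.I • y‖ = 1 := by rw [norm_smul]; simp [hy]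
    have hk : ∀ k : Fin 4, ‖(![1, -1, -Complex.I, Complex.I] k / 4) *
        ((S.scalarMeasure (![x + y, x - y, x + Complex.I • y, x - Complex.I • y] k)).real Δ : ℂ)‖
        ≤ C := by
      intro k
      have h1 : ‖(![1, -1, -Complex.I, Complex.I] k / 4 : ℂ)‖ = 1 / 4 := by
        fin_cases k <;> simp
      have h2 : ‖![x + y, x - y, x + Complex.I • y, x - Complex.I • y] k‖ ≤ 2 := by
        fin_cases k
        · exact (norm_add_le _ _).trans (by linarith)
        · exact (norm_sub_le _ _).trans (by linarith)
        · exact (norm_add_le _ _).trans (by linarith)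
        · exact (norm_sub_le _ _).trans (by linarith)
      rw [norm_mul, h1, Complex.norm_real, Real.norm_of_nonneg measureReal_nonneg]
      linarith [hv _ h2]
    refine (norm_sum_le _ _).trans ((Finset.sum_le_sum fun k _ => hk k).trans ?_)
    simp
  refine ⟨4 * C, fun x y => ?_⟩
  rcases eq_or_ne x 0 with rfl | hx
  · have := S.polar_smul_left hm hb 0 0 y
    simp at this; simp [this]
  rcases eq_or_ne y 0 with rfl | hy
  · have := S.polar_smul_right hm hb 0 x 0
    simp at this; simp [this]
  have hx' : ‖x‖ ≠ 0 := norm_ne_zero_iff.2 hx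
  have hy' : ‖y‖ ≠ 0 := norm_ne_zero_iff.2 hy
  have h := hbd ((‖x‖⁻¹ : ℂ) • x) ((‖y‖⁻¹ : ℂ) • y)
    (by rw [norm_smul]; simp [hx']) (by rw [norm_smul]; simp [hy'])
  rw [S.polar_smul_left hm hb, S.polar_smul_right hm hb] at h
  simp only [norm_mul, map_inv₀, Complex.conj_ofReal, norm_inv, Complex.norm_real,
    norm_norm] at h
  have e : ‖S.polar Δ x y‖ = (‖x‖⁻¹ * (‖y‖⁻¹ * ‖S.polar Δ x y‖)) * ‖x‖ * ‖y‖ := by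
    field_simp
  rw [e]
  gcongr

lemma exists_opMeasure {Δ : Set ℝ} (hm : MeasurableSet Δ) (hb : Bornology.IsBounded Δ) :
    ∃ A : H →L[ℂ] H, ∀ x, ⟪x, A x⟫_ℂ = ((S.scalarMeasure x).real Δ : ℂ) := by
  obtain ⟨C, hC⟩ := S.exists_norm_polar_le hm hb
  let B : H →ₗ⋆[ℂ] H →ₗ[ℂ] ℂ := LinearMap.mk₂'ₛₗ (starRingEnd ℂ) (RingHom.id ℂ) (S.polar Δ)
    (S.polar_add_left hm hb) (S.polar_smul_left hm hb) (S.polar_add_right hm hb)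
    (S.polar_smul_right hm hb)
  let B' : H →L⋆[ℂ] H →L[ℂ] ℂ := B.mkContinuous₂ C hC
  refine ⟨InnerProductSpace.continuousLinearMapOfBilin B', fun x => ?_⟩
  rw [← inner_conj_symm, InnerProductSpace.continuousLinearMapOfBilin_apply]
  change (starRingEnd ℂ) (S.polar Δ x x) = _
  rw [S.polar_self x hm hb, Complex.conj_ofReal]

open scoped Classical in
/-- The operator measure `Σ(Δ)`, for bounded Borel sets `Δ`: the bounded operator with
`(Σ(Δ)x, x) = μ_x(Δ)` for all `x`; in particular `Σ([a,b)) = Σ(b) - Σ(a)`. -/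
def opMeasure (Δ : Set ℝ) : H →L[ℂ] H :=
  if h : MeasurableSet Δ ∧ Bornology.IsBounded Δ then (S.exists_opMeasure h.1 h.2).choose else 0

lemma inner_opMeasure {Δ : Set ℝ} (hm : MeasurableSet Δ) (hb : Bornology.IsBounded Δ) (x : H) :
    ⟪x, S.opMeasure Δ x⟫_ℂ = ((S.scalarMeasure x).real Δ : ℂ) := by
  rw [opMeasure, dif_pos ⟨hm, hb⟩]
  exact (S.exists_opMeasure hm hb).choose_spec x

lemma opMeasure_Ico {a b : ℝ} (h : a ≤ b) : S.opMeasure (Ico a b) = S.toFun b - S.toFun a := by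
  rw [← sub_eq_zero]
  have : ((S.opMeasure (Ico a b) - (S.toFun b - S.toFun a) : H →L[ℂ] H) : H →ₗ[ℂ] H) = 0 := by
    rw [← inner_map_self_eq_zero]
    intro x
    have h1 := S.inner_opMeasure measurableSet_Ico (Metric.isBounded_Ico a b) x
    rw [S.scalarMeasure_Ico_inner x h] at h1
    have h2 : ⟪x, (S.opMeasure (Ico a b) - (S.toFun b - S.toFun a)) x⟫_ℂ = 0 := by
      rw [_root_.sub_apply, inner_sub_right, h1]
      simp [incr, inner_sub_right]
    rw [← inner_conj_symm]
    have := congrArg (starRingEnd ℂ) h2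
    rw [inner_conj_symm, map_zero] at this
    rw [inner_conj_symm]
    exact this
  ext x
  exact congrArg (fun L : H →ₗ[ℂ] H => L x) this

/-- `ρ ∼ Σ`: the scalar measure `ρ` and the operator measure have the same null sets among the
bounded Borel sets. -/
def Equivalent (ρ : Measure ℝ) : Prop :=
  ∀ Δ : Set ℝ, MeasurableSet Δ → Bornology.IsBounded Δ → (ρ Δ = 0 ↔ S.opMeasure Δ = 0)

end Distribution

/-- A tagged partition `t₀ ≤ t₁ ≤ … ≤ tₙ` of a compact interval, with tags `ξₖ ∈ [tₖ, tₖ₊₁]`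
(only the indices `k ≤ n` matter). -/
structure TaggedPartition where
  n : ℕ
  pt : ℕ → ℝ
  tag : ℕ → ℝ
  mono : Monotone pt
  tag_mem : ∀ k, tag k ∈ Icc (pt k) (pt (k + 1))

namespace TaggedPartition

/-- The mesh of a tagged partition. -/
def mesh (P : TaggedPartition) : ℝ := ⨆ k : Fin P.n, (P.pt (k + 1) - P.pt k)

/-- The filter of tagged partitions whose mesh tends to `0` and whose intervals `[t₀, tₙ]`
exhaust `ℝ`. -/
def fine : Filter TaggedPartition :=
  comap mesh (𝓝 0) ⊓ comap (fun P => P.pt 0) atBot ⊓ comap (fun P => P.pt P.n) atTop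

/-- The uniform partition of `[-(N+1), N+1]` with step `1/(N+1)`. -/
def uniform (N : ℕ) : TaggedPartition where
  n := 2 * (N + 1) ^ 2
  pt k := -(N + 1 : ℝ) + k / (N + 1 : ℝ)
  tag k := -(N + 1 : ℝ) + k / (N + 1 : ℝ)
  mono := by
    intro a b h
    have : (a : ℝ) ≤ b := by exact_mod_cast h
    simp only
    gcongr
  tag_mem k := by
    refine ⟨le_rfl, ?_⟩
    push_cast
    gcongr
    simp

lemma tendsto_uniform : Tendsto uniform atTop fine := by
  have h1 : Tendsto (fun N : ℕ => (N : ℝ) + 1) atTop atTop :=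
    tendsto_atTop_add_const_right _ _ tendsto_natCast_atTop_atTop
  refine tendsto_inf.2 ⟨tendsto_inf.2 ⟨?_, ?_⟩, ?_⟩ <;> rw [tendsto_comap_iff]
  · have : mesh ∘ uniform = fun N : ℕ => 1 / ((N : ℝ) + 1) := by
      ext N
      have : ∀ k : Fin (uniform N).n, ((uniform N).pt (k + 1) - (uniform N).pt k)
          = 1 / ((N : ℝ) + 1) := by
        intro k
        simp only [uniform]
        push_cast
        ring
      simp only [Function.comp, mesh, this]
      have : Nonempty (Fin (uniform N).n) := ⟨⟨0, by simp [uniform]⟩⟩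
      exact ciSup_const
    rw [this]
    exact tendsto_one_div_add_atTop_nhds_zero_nat
  · have : (fun P : TaggedPartition => P.pt 0) ∘ uniform = fun N : ℕ => -((N : ℝ) + 1) := by
      ext N; simp [uniform]
    rw [this]
    exact tendsto_neg_atTop_atBot.comp h1
  · have : (fun P : TaggedPartition => P.pt P.n) ∘ uniform = fun N : ℕ => (N : ℝ) + 1 := by
      ext N
      simp only [Function.comp, uniform]
      push_cast
      field_simp
      ring
    rw [this]
    exact h1

instance : NeBot fine := tendsto_uniform.neBot

lemma pt_succ_sub_le (P : TaggedPartition) {k : ℕ} (hk : k < P.n) :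
    P.pt (k + 1) - P.pt k ≤ P.mesh :=
  le_ciSup (f := fun k : Fin P.n => P.pt (k + 1) - P.pt k) (finite_range _).bddAbove ⟨k, hk⟩

lemma biUnion_Ico (P : TaggedPartition) (m : ℕ) :
    ⋃ k ∈ Finset.range m, Ico (P.pt k) (P.pt (k + 1)) = Ico (P.pt 0) (P.pt m) := by
  induction m with
  | zero => simp
  | succ m ih =>
    rw [Finset.range_add_one, Finset.set_biUnion_insert, ih, union_comm,
      Ico_union_Ico_eq_Ico (P.mono (Nat.zero_le _)) (P.mono (Nat.le_succ _))]

lemma pairwise_disjoint (P : TaggedPartition) :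
    Pairwise (Function.onFun Disjoint fun k => Ico (P.pt k) (P.pt (k + 1))) := by
  have := P.mono.pairwise_disjoint_on_Ico_succ
  simpa using this

/-- Riemann sums of a compactly supported continuous function converge to its integral. -/
lemma tendsto_sum_integral (ν : Measure ℝ) [IsLocallyFiniteMeasure ν] (h : ℝ → ℂ)
    (hc : Continuous h) (hs : HasCompactSupport h) :
    Tendsto (fun P : TaggedPartition => ∑ k ∈ Finset.range P.n,
      h (P.tag k) * (ν.real (Ico (P.pt k) (P.pt (k + 1))) : ℂ)) fine (𝓝 (∫ t, h t ∂ν)) := by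
  obtain ⟨M, hM0, hM⟩ := hs.isCompact.isBounded.subset_closedBall_lt 0 0
  have hz : ∀ x, M < |x| → h x = 0 := by
    intro x hx
    by_contra hne
    have := hM (subset_tsupport h hne)
    rw [mem_closedBall_zero_iff, Real.norm_eq_abs] at this
    linarith
  set K : Set ℝ := Ico (-(M + 1)) (M + 1) with hK
  have hKm : MeasurableSet K := measurableSet_Ico
  have hKfin : ν K ≠ ∞ := (Metric.isBounded_Ico _ _).measure_lt_top.ne
  have hint : Integrable h ν := hc.integrable_of_hasCompactSupport hs
  have huc : UniformContinuous h := hc.uniformContinuous_of_tendsto_cocompact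
    (hs.is_zero_at_infty)
  rw [Metric.tendsto_nhds]
  intro ε hε
  set η : ℝ := ε / (2 * (ν.real K + 1)) with hη
  have hKr : 0 ≤ ν.real K := measureReal_nonneg
  have hη0 : 0 < η := by positivity
  obtain ⟨δ, hδ, hδ'⟩ := Metric.uniformContinuous_iff.1 huc η hη0
  have e1 : ∀ᶠ P in fine, P.mesh < min δ 1 := by
    have : Tendsto mesh fine (𝓝 0) := tendsto_comap.mono_left (inf_le_left.trans inf_le_left)
    exact this.eventually (gt_mem_nhds (by positivity))
  have e2 : ∀ᶠ P in fine, P.pt 0 ≤ -(M + 1) := by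
    have : Tendsto (fun P : TaggedPartition => P.pt 0) fine atBot :=
      tendsto_comap.mono_left (inf_le_left.trans inf_le_right)
    exact this.eventually (eventually_le_atBot _)
  have e3 : ∀ᶠ P in fine, M + 1 ≤ P.pt P.n := by
    have : Tendsto (fun P : TaggedPartition => P.pt P.n) fine atTop :=
      tendsto_comap.mono_left inf_le_right
    exact this.eventually (eventually_ge_atTop _)
  filter_upwards [e1, e2, e3] with P h1 h2 h3
  set I : ℕ → Set ℝ := fun k => Ico (P.pt k) (P.pt (k + 1)) with hI
  have hIm : ∀ k, MeasurableSet (I k) := fun k => measurableSet_Ico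
  have hIfin : ∀ k, ν (I k) ≠ ∞ := fun k => (Metric.isBounded_Ico _ _).measure_lt_top.ne
  have hU : ⋃ k ∈ Finset.range P.n, I k = Ico (P.pt 0) (P.pt P.n) := P.biUnion_Ico P.n
  have hd : (↑(Finset.range P.n) : Set ℕ).PairwiseDisjoint I :=
    fun i _ j _ hij => P.pairwise_disjoint hij
  have s1 : ∫ t, h t ∂ν = ∑ k ∈ Finset.range P.n, ∫ t in I k, h t ∂ν := by
    rw [← integral_biUnion_finset _ (fun k _ => hIm k) hd (fun k _ => hint.integrableOn), hU]
    symm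
    apply setIntegral_eq_integral_of_forall_compl_eq_zero
    intro x hx
    apply hz
    by_contra hcon
    rw [not_lt, abs_le] at hcon
    exact hx ⟨by linarith [hcon.1], by linarith [hcon.2]⟩
  have s2 : ∀ k, h (P.tag k) * (ν.real (I k) : ℂ) = ∫ _ in I k, h (P.tag k) ∂ν := by
    intro k
    rw [setIntegral_const, Complex.real_smul, mul_comm]
  have s3 : ∀ k ∈ Finset.range P.n,
      ‖(∫ _ in I k, h (P.tag k) ∂ν) - ∫ t in I k, h t ∂ν‖ ≤ η * ν.real (I k ∩ K) := by
    intro k hk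
    have hk' := P.pt_succ_sub_le (Finset.mem_range.1 hk)
    have hcI : IntegrableOn (fun _ => h (P.tag k)) (I k) ν := integrableOn_const (hIfin k)
    rw [← integral_sub hcI hint.integrableOn]
    have hpt : ∀ x ∈ I k, ‖h (P.tag k) - h x‖ ≤ K.indicator (fun _ => η) x := by
      intro x hx
      have ht := P.tag_mem k
      have hdist : |P.tag k - x| < min δ 1 := by
        rw [abs_lt]
        constructor <;> linarith [hx.1, hx.2, ht.1, ht.2]
      by_cases hxK : x ∈ K
      · rw [indicator_of_mem hxK, ← dist_eq_norm]
        exact (hδ' (by rw [Real.dist_eq]; exact hdist.trans_le (min_le_left _ _))).le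
      · have hx1 : M + 1 ≤ |x| := by
          by_contra hcon
          rw [not_le, abs_lt] at hcon
          exact hxK ⟨hcon.1.le, hcon.2⟩
        have hx2 : M < |P.tag k| := by
          have := abs_sub_abs_le_abs_sub x (P.tag k)
          rw [abs_sub_comm] at this
          linarith [hdist.trans_le (min_le_right _ _)]
        rw [indicator_of_notMem hxK, hz x (by linarith), hz _ hx2]
        simp
    have hKi : Integrable (K.indicator fun _ => η) ν :=
      (integrable_indicator_iff hKm).2 (integrableOn_const hKfin)
    calc _ ≤ ∫ x in I k, K.indicator (fun _ => η) x ∂ν :=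
          norm_integral_le_of_norm_le hKi.integrableOn
            ((ae_restrict_iff' (hIm k)).2 (ae_of_all _ hpt))
      _ = η * ν.real (I k ∩ K) := by
          rw [setIntegral_indicator hKm, setIntegral_const, smul_eq_mul, mul_comm]
  rw [dist_eq_norm, s1]
  change ‖(∑ k ∈ Finset.range P.n, h (P.tag k) * (ν.real (I k) : ℂ)) - _‖ < ε
  simp_rw [s2]
  rw [← Finset.sum_sub_distrib]
  calc _ ≤ ∑ k ∈ Finset.range P.n, η * ν.real (I k ∩ K) :=
        (norm_sum_le _ _).trans (Finset.sum_le_sum s3)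
    _ = η * ν.real (⋃ k ∈ Finset.range P.n, (I k ∩ K)) := by
        rw [← Finset.mul_sum, measureReal_biUnion_finset]
        · exact fun i hi j hj hij => (hd hi hj hij).mono inter_subset_left inter_subset_left
        · exact fun k _ => (hIm k).inter hKm
    _ ≤ η * ν.real K := by
        gcongr
        exact iUnion₂_subset fun k _ => inter_subset_right
    _ < ε := by
        rw [hη, div_mul_eq_mul_div, div_lt_iff₀ (by positivity)]
        nlinarith

end TaggedPartition

/-- `C₀₀(H)`: the continuous compactly supported functions `ℝ → H` with values in a
finite-dimensional subspace (depending on the function). -/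
def C00 (H : Type*) [NormedAddCommGroup H] [InnerProductSpace ℂ H] : Submodule ℂ (ℝ → H) where
  carrier := {f | Continuous f ∧ HasCompactSupport f ∧
    ∃ F : Submodule ℂ H, FiniteDimensional ℂ F ∧ ∀ t, f t ∈ F}
  add_mem' := by
    rintro f g ⟨hf, hf', F, hF, hfF⟩ ⟨hg, hg', G, hG, hgG⟩
    refine ⟨hf.add hg, hf'.add hg', F ⊔ G, inferInstance, fun t => ?_⟩
    exact Submodule.add_mem_sup (hfF t) (hgG t)
  zero_mem' := ⟨continuous_const, HasCompactSupport.zero, ⊥, inferInstance, fun t => by simp⟩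
  smul_mem' := by
    rintro c f ⟨hf, hf', F, hF, hfF⟩
    exact ⟨hf.const_smul c, hf'.smul_left (f := fun _ => c), F, hF, fun t => F.smul_mem c (hfF t)⟩

lemma exists_sum_of_mem_C00 {H : Type*} [NormedAddCommGroup H] [InnerProductSpace ℂ H] (f : C00 H) :
    ∃ (n : ℕ) (φ : Fin n → ℝ → ℂ) (e : Fin n → H), (∀ i, Continuous (φ i)) ∧
      (∀ i, HasCompactSupport (φ i)) ∧ ∀ t, f.1 t = ∑ i, φ i t • e i := by
  obtain ⟨hc, hs, F, hF, hfF⟩ := f.2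
  let b := Module.finBasis ℂ F
  let L : ∀ i, F →L[ℂ] ℂ := fun i => LinearMap.toContinuousLinearMap (b.coord i)
  have hcF : Continuous fun t => (⟨f.1 t, hfF t⟩ : F) := hc.subtype_mk _
  refine ⟨_, fun i t => L i ⟨f.1 t, hfF t⟩, fun i => b i, fun i => (L i).continuous.comp hcF,
    fun i => ?_, fun t => ?_⟩
  · refine hs.mono fun t ht => ?_
    rw [Function.mem_support] at ht ⊢
    intro h0
    apply ht
    have : (⟨f.1 t, hfF t⟩ : F) = 0 := Subtype.ext h0
    change L i ⟨f.1 t, hfF t⟩ = 0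
    rw [this, map_zero]
  · have := b.sum_repr ⟨f.1 t, hfF t⟩
    have h2 := congrArg (F.subtype) this
    rw [map_sum] at h2
    exact h2.symm

namespace Distribution

variable (S : Distribution H)

lemma polar_Ico {a b : ℝ} (h : a ≤ b) (x y : H) :
    S.polar (Ico a b) x y = ⟪x, S.incr a b y⟫_ℂ := by
  rw [← inner_polarization (S.incr a b) x y, polar]
  simp_rw [S.scalarMeasure_Ico_inner _ h]

/-- The Riemann sum `∑ₖ ((Σ(tₖ₊₁) - Σ(tₖ)) g(ξₖ), f(ξₖ))` of the integral `∫ (dΣ(t) g(t), f(t))`.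
(Mathlib's inner product is conjugate linear in the first argument.) -/
def riemannSum (f g : ℝ → H) (P : TaggedPartition) : ℂ :=
  ∑ k ∈ Finset.range P.n, ⟪f (P.tag k), S.incr (P.pt k) (P.pt (k + 1)) (g (P.tag k))⟫_ℂ

/-- The integral `∫ (dΣ(t) g(t), f(t))`, as the limit of its Riemann sums. -/
def form (f g : ℝ → H) : ℂ := limUnder TaggedPartition.fine (S.riemannSum f g)

lemma tendsto_form (f g : C00 H) :
    Tendsto (S.riemannSum f.1 g.1) TaggedPartition.fine (𝓝 (S.form f.1 g.1)) := by
  apply tendsto_nhds_limUnder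
  obtain ⟨n, φ, e, hφ, hφs, hf⟩ := exists_sum_of_mem_C00 f
  obtain ⟨m, ψ, d, hψ, hψs, hg⟩ := exists_sum_of_mem_C00 g
  have key : S.riemannSum f.1 g.1 = fun P => ∑ i, ∑ j, ∑ l : Fin 4,
      (![1, -1, -Complex.I, Complex.I] l / 4) * ∑ k ∈ Finset.range P.n,
        ((starRingEnd ℂ) (φ i (P.tag k)) * ψ j (P.tag k)) *
        ((S.scalarMeasure (![e i + d j, e i - d j, e i + Complex.I • d j,
          e i - Complex.I • d j] l)).real (Ico (P.pt k) (P.pt (k + 1))) : ℂ) := by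
    ext P
    have h1 : ∀ k, ⟪f.1 (P.tag k), S.incr (P.pt k) (P.pt (k + 1)) (g.1 (P.tag k))⟫_ℂ
        = ∑ i, ∑ j, ∑ l : Fin 4, (![1, -1, -Complex.I, Complex.I] l / 4) *
          (((starRingEnd ℂ) (φ i (P.tag k)) * ψ j (P.tag k)) *
          ((S.scalarMeasure (![e i + d j, e i - d j, e i + Complex.I • d j,
          e i - Complex.I • d j] l)).real (Ico (P.pt k) (P.pt (k + 1))) : ℂ)) := by
      intro k
      rw [hf, hg, map_sum, sum_inner]
      refine Finset.sum_congr rfl fun i _ => ?_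
      rw [inner_sum]
      refine Finset.sum_congr rfl fun j _ => ?_
      rw [map_smul, inner_smul_left, inner_smul_right,
        ← S.polar_Ico (P.mono (Nat.le_succ k)), polar, Finset.mul_sum, Finset.mul_sum]
      refine Finset.sum_congr rfl fun l _ => ?_
      ring
    rw [riemannSum]
    simp_rw [h1]
    rw [Finset.sum_comm]
    refine Finset.sum_congr rfl fun i _ => ?_
    rw [Finset.sum_comm]
    refine Finset.sum_congr rfl fun j _ => ?_
    rw [Finset.sum_comm]
    refine Finset.sum_congr rfl fun l _ => ?_
    rw [Finset.mul_sum]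
  rw [key]
  refine ⟨_, tendsto_finsetSum _ fun i _ => tendsto_finsetSum _ fun j _ =>
    tendsto_finsetSum _ fun l _ => Tendsto.const_mul _
      (TaggedPartition.tendsto_sum_integral _
        (fun t => (starRingEnd ℂ) (φ i t) * ψ j t) ?_ ?_)⟩
  · exact (Complex.continuous_conj.comp (hφ i)).mul (hψ j)
  · exact (hψs j).mul_left

/-- The space `C₀₀(H)` regarded with the (semidefinite) inner product of `L₂(Σ, H)`. -/
def PreL2 (_S : Distribution H) : Type _ := C00 H

instance : AddCommGroup S.PreL2 := inferInstanceAs (AddCommGroup (C00 H))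

instance : Module ℂ S.PreL2 := inferInstanceAs (Module ℂ (C00 H))

/-- An element of `C₀₀(H)` as an element of the pre-Hilbert space. -/
def toPreL2 : C00 H ≃ₗ[ℂ] S.PreL2 := LinearEquiv.refl ℂ _

lemma form_unique (f g : C00 H) {c : ℂ}
    (h : Tendsto (S.riemannSum f.1 g.1) TaggedPartition.fine (𝓝 c)) : S.form f.1 g.1 = c :=
  tendsto_nhds_unique (S.tendsto_form f g) h

/-- The inner product `(f, g) ↦ ∫ (dΣ(t) g(t), f(t))` on `C₀₀(H)`. -/
@[reducible] def preL2Core : PreInnerProductSpace.Core ℂ S.PreL2 where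
  inner f g := S.form (S.toPreL2.symm f).1 (S.toPreL2.symm g).1
  conj_inner_symm f g := by
    symm
    apply S.form_unique (S.toPreL2.symm f) (S.toPreL2.symm g)
    have := (Complex.continuous_conj.tendsto _).comp
      (S.tendsto_form (S.toPreL2.symm g) (S.toPreL2.symm f))
    refine this.congr fun P => ?_
    simp only [Function.comp, riemannSum, map_sum, inner_conj_symm]
    refine Finset.sum_congr rfl fun k _ => ?_
    exact (S.incr_isPositive (P.mono (Nat.le_succ k))).inner_left_eq_inner_right _ _
  re_inner_nonneg f := by
    refine ge_of_tendsto' ((Complex.continuous_re.tendsto _).comp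
      (S.tendsto_form (S.toPreL2.symm f) (S.toPreL2.symm f))) fun P => ?_
    simp only [Function.comp, riemannSum, Complex.re_sum]
    exact Finset.sum_nonneg fun k _ =>
      (S.incr_isPositive (P.mono (Nat.le_succ k))).re_inner_nonneg_right _
  add_left f g h := by
    apply S.form_unique (S.toPreL2.symm (f + g)) (S.toPreL2.symm h)
    refine ((S.tendsto_form (S.toPreL2.symm f) (S.toPreL2.symm h)).add
      (S.tendsto_form (S.toPreL2.symm g) (S.toPreL2.symm h))).congr fun P => ?_
    simp [riemannSum, ← Finset.sum_add_distrib]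
  smul_left f g r := by
    apply S.form_unique (S.toPreL2.symm (r • f)) (S.toPreL2.symm g)
    refine ((S.tendsto_form (S.toPreL2.symm f) (S.toPreL2.symm g)).const_mul _).congr
      fun P => ?_
    simp [riemannSum, Finset.mul_sum, mul_comm]

instance : SeminormedAddCommGroup S.PreL2 :=
  @InnerProductSpace.Core.toSeminormedAddCommGroup ℂ _ _ _ _ S.preL2Core

instance : InnerProductSpace ℂ S.PreL2 := InnerProductSpace.ofCore S.preL2Core

/-- The Hilbert space `L₂(Σ, H)`: the Hausdorff completion of `C₀₀(H)`, that is, the completion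
of its quotient by the null vectors of the inner product. -/
abbrev L2 : Type _ := UniformSpace.Completion S.PreL2

/-- The class in `L₂(Σ, H)` of a function in `C₀₀(H)`. -/
def toL2 (f : C00 H) : S.L2 := (S.toPreL2 f : UniformSpace.Completion S.PreL2)

lemma inner_toL2 (f g : C00 H) : ⟪S.toL2 f, S.toL2 g⟫_ℂ = S.form f.1 g.1 :=
  UniformSpace.Completion.inner_coe _ _

end Distribution

/-- `T` is a Hilbert-Schmidt operator. -/
def IsHilbertSchmidt (T : H →L[ℂ] H) : Prop :=
  ∃ (w : Set H) (b : HilbertBasis w ℂ H), Summable fun i => ‖T (b i)‖ ^ 2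

/-- `A` is a trace class operator: the trace of `|A|` is finite. -/
def IsTraceClass (A : H →L[ℂ] H) : Prop :=
  ∃ (w : Set H) (b : HilbertBasis w ℂ H), Summable fun i => (⟪b i, CFC.abs A (b i)⟫_ℂ).re

/-- `Ψ` is a density `d(T*ΣT)/dρ`, in the weak sense, of the operator measure
`Σ_T(Δ) = T* Σ(Δ) T`. -/
structure IsBGKDensity (S : Distribution H) (T : H →L[ℂ] H) (ρ : Measure ℝ)
    (Ψ : ℝ → H →L[ℂ] H) : Prop where
  nonneg : ∀ᵐ t ∂ρ, 0 ≤ Ψ t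
  integrableOn : ∀ Δ : Set ℝ, MeasurableSet Δ → Bornology.IsBounded Δ → ∀ x y : H,
    IntegrableOn (fun t => ⟪x, Ψ t y⟫_ℂ) Δ ρ
  setIntegral_eq : ∀ Δ : Set ℝ, MeasurableSet Δ → Bornology.IsBounded Δ → ∀ x y : H,
    ⟪x, (T.adjoint ∘L S.opMeasure Δ ∘L T) y⟫_ℂ = ∫ t in Δ, ⟪x, Ψ t y⟫_ℂ ∂ρ

lemma IsBGKDensity.aestronglyMeasurable {S : Distribution H} {T : H →L[ℂ] H} {ρ : Measure ℝ}
    {Ψ : ℝ → H →L[ℂ] H} (h : IsBGKDensity S T ρ Ψ) (x y : H) :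
    AEStronglyMeasurable (fun t => ⟪x, Ψ t y⟫_ℂ) ρ := by
  have h1 : ∀ n : ℕ, AEStronglyMeasurable (fun t => ⟪x, Ψ t y⟫_ℂ)
      (ρ.restrict (Ioo (-(n : ℝ)) n)) := fun n =>
    (h.integrableOn _ measurableSet_Ioo (Metric.isBounded_Ioo _ _) x y).aestronglyMeasurable
  have h2 := (aestronglyMeasurable_iUnion_iff (μ := ρ)).2 h1
  have h3 : ⋃ n : ℕ, Ioo (-(n : ℝ)) n = univ := by
    refine eq_univ_of_forall fun t => mem_iUnion.2 ?_
    obtain ⟨n, hn⟩ := exists_nat_gt |t|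
    exact ⟨n, abs_lt.1 hn⟩
  rwa [h3, Measure.restrict_univ] at h2

section DirectIntegral

variable {α : Type*} [MeasurableSpace α]

/-- The measurable structure of a field `t ↦ 𝓗 t` of Hilbert spaces: a fundamental family `e` of
sections, with (almost everywhere) measurable mutual inner products, and containing a sequence
which is total in almost every `𝓗 t`. -/
structure MeasurableField (μ : Measure α) (𝓗 : α → Type*) [∀ t, NormedAddCommGroup (𝓗 t)]
    [∀ t, InnerProductSpace ℂ (𝓗 t)] (ι : Type*) where
  /-- the fundamental family of sections -/
  e : ι → ∀ t, 𝓗 t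
  measurable_inner : ∀ i j, AEStronglyMeasurable (fun t => ⟪e i t, e j t⟫_ℂ) μ
  exists_total : ∃ c : ℕ → ι, ∀ᵐ t ∂μ,
    Dense (Submodule.span ℂ (range fun n => e (c n) t) : Set (𝓗 t))

namespace MeasurableField

variable {μ : Measure α} {𝓗 : α → Type*} [∀ t, NormedAddCommGroup (𝓗 t)]
  [∀ t, InnerProductSpace ℂ (𝓗 t)] {ι : Type*} (F : MeasurableField μ 𝓗 ι)

/-- A section is measurable if its inner products with the fundamental family are. -/
def IsMeasurableSection (s : ∀ t, 𝓗 t) : Prop :=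
  ∀ i, AEStronglyMeasurable (fun t => ⟪F.e i t, s t⟫_ℂ) μ

variable {F} in
lemma IsMeasurableSection.add {s s' : ∀ t, 𝓗 t} (h : F.IsMeasurableSection s)
    (h' : F.IsMeasurableSection s') : F.IsMeasurableSection (s + s') := fun i => by
  simp only [Pi.add_apply, inner_add_right]
  exact (h i).add (h' i)

variable {F} in
lemma IsMeasurableSection.smul {s : ∀ t, 𝓗 t} (h : F.IsMeasurableSection s) (c : ℂ) :
    F.IsMeasurableSection (c • s) := fun i => by
  simp only [Pi.smul_apply, inner_smul_right]
  exact (h i).const_mul c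

lemma norm_eq_iSup {E : Type*} [NormedAddCommGroup E] [InnerProductSpace ℂ E] {β : Type*}
    (d : β → E) (hd : DenseRange d) (s : E) :
    ENNReal.ofReal ‖s‖ = ⨆ n, ENNReal.ofReal (‖⟪d n, s⟫_ℂ‖ / ‖d n‖) := by
  apply le_antisymm
  · apply le_of_forall_lt
    intro c hc
    have hs : s ≠ 0 := by
      rintro rfl
      simp at hc
    have hcont : ContinuousAt (fun x : E => ENNReal.ofReal (‖⟪x, s⟫_ℂ‖ / ‖x‖)) s := by
      apply ENNReal.continuous_ofReal.continuousAt.comp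
      exact ContinuousAt.div (by fun_prop) (by fun_prop) (norm_ne_zero_iff.2 hs)
    have hval : ENNReal.ofReal (‖⟪s, s⟫_ℂ‖ / ‖s‖) = ENNReal.ofReal ‖s‖ := by
      have hs' : ‖s‖ ≠ 0 := norm_ne_zero_iff.2 hs
      congr 1
      rw [inner_self_eq_norm_sq_to_K]
      simp
      field_simp
    have hev : ∀ᶠ x in 𝓝 s, c < ENNReal.ofReal (‖⟪x, s⟫_ℂ‖ / ‖x‖) := by
      refine hcont.eventually (lt_mem_nhds ?_)
      change c < ENNReal.ofReal (‖⟪s, s⟫_ℂ‖ / ‖s‖)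
      exact hval.symm ▸ (show c < ENNReal.ofReal ‖s‖ from hc)
    obtain ⟨_, hx, n, rfl⟩ := (mem_closure_iff_nhds.1 (hd s)) _ hev
    exact hx.trans_le (le_iSup (fun n => ENNReal.ofReal (‖⟪d n, s⟫_ℂ‖ / ‖d n‖)) n)
  · refine iSup_le fun n => ENNReal.ofReal_le_ofReal ?_
    refine div_le_of_le_mul₀ (norm_nonneg _) (norm_nonneg _) ?_
    rw [mul_comm]
    exact norm_inner_le_norm _ _

/-- Linear combinations, with coefficients from a countable dense set, of a sequence. -/
def combination {E : Type*} [NormedAddCommGroup E] [InnerProductSpace ℂ E] (v : ℕ → E)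
    (p : Σ n : ℕ, (Fin n → ℕ)) : E := ∑ i, TopologicalSpace.denseSeq ℂ (p.2 i) • v i

lemma denseRange_combination {E : Type*} [NormedAddCommGroup E] [InnerProductSpace ℂ E]
    (v : ℕ → E) (hv : Dense (Submodule.span ℂ (range v) : Set E)) :
    DenseRange (combination v) := by
  refine dense_closure.1 (hv.mono ?_)
  intro x hx
  obtain ⟨c, rfl⟩ := Finsupp.mem_span_range_iff_exists_finsupp.1 hx
  obtain ⟨n, hn⟩ : ∃ n, c.support ⊆ Finset.range n := c.support.exists_nat_subset_range
  have e1 : (c.sum fun i a => a • v i) = ∑ i : Fin n, c i • v i := by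
    rw [Finsupp.sum_of_support_subset c hn _ (by simp), ← Fin.sum_univ_eq_sum_range
      (fun i => c i • v i)]
  rw [e1]
  have hG : Continuous fun a : Fin n → ℂ => ∑ i : Fin n, a i • v i := by fun_prop
  have hd : DenseRange (Pi.map fun _ : Fin n => TopologicalSpace.denseSeq ℂ) :=
    DenseRange.piMap fun _ => TopologicalSpace.denseRange_denseSeq ℂ
  have := image_closure_subset_closure_image hG (mem_image_of_mem _ (hd fun i => c i))
  refine closure_mono ?_ this
  rintro _ ⟨_, ⟨k, rfl⟩, rfl⟩
  exact ⟨⟨n, k⟩, rfl⟩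

variable {F} in
lemma aestronglyMeasurable_inner_combination {s : ∀ t, 𝓗 t} (h : F.IsMeasurableSection s)
    (c : ℕ → ι) (p : Σ n : ℕ, (Fin n → ℕ)) :
    AEStronglyMeasurable (fun t => ⟪combination (fun n => F.e (c n) t) p, s t⟫_ℂ) μ := by
  simp only [combination, sum_inner, inner_smul_left]
  exact Finset.aestronglyMeasurable_fun_sum _ fun i _ => (h (c i)).const_mul _

lemma isMeasurableSection_combination (c : ℕ → ι) (p : Σ n : ℕ, (Fin n → ℕ)) :
    F.IsMeasurableSection (fun t => combination (fun n => F.e (c n) t) p) := fun i => by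
  simp only [combination, inner_sum, inner_smul_right]
  exact Finset.aestronglyMeasurable_fun_sum _ fun j _ => (F.measurable_inner _ _).const_mul _

lemma aestronglyMeasurable_norm_combination (c : ℕ → ι) (p : Σ n : ℕ, (Fin n → ℕ)) :
    AEStronglyMeasurable (fun t => ‖combination (fun n => F.e (c n) t) p‖) μ := by
  have h := aestronglyMeasurable_inner_combination (F.isMeasurableSection_combination c p) c p
  have h2 := Real.continuous_sqrt.comp_aestronglyMeasurable
    (Complex.continuous_re.comp_aestronglyMeasurable h)
  refine h2.congr (ae_of_all _ fun t => ?_)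
  exact (norm_eq_sqrt_re_inner (𝕜 := ℂ) _).symm

variable {F} in
lemma IsMeasurableSection.norm {s : ∀ t, 𝓗 t} (h : F.IsMeasurableSection s) :
    AEStronglyMeasurable (fun t => ‖s t‖) μ := by
  obtain ⟨c, hc⟩ := F.exists_total
  have hsup : AEMeasurable (fun t => ⨆ p : Σ n : ℕ, (Fin n → ℕ),
      ENNReal.ofReal (‖⟪combination (fun n => F.e (c n) t) p, s t⟫_ℂ‖ /
        ‖combination (fun n => F.e (c n) t) p‖)) μ :=
    AEMeasurable.iSup fun p =>
      ((aestronglyMeasurable_inner_combination h c p).norm.aemeasurable.div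
        (F.aestronglyMeasurable_norm_combination c p).aemeasurable).ennreal_ofReal
  refine (hsup.ennreal_toReal.congr ?_).aestronglyMeasurable
  filter_upwards [hc] with t ht
  have := norm_eq_iSup (combination fun n => F.e (c n) t) (denseRange_combination _ ht) (s t)
  rw [← this, ENNReal.toReal_ofReal (norm_nonneg _)]

variable {F} in
lemma IsMeasurableSection.inner {s s' : ∀ t, 𝓗 t} (h : F.IsMeasurableSection s)
    (h' : F.IsMeasurableSection s') : AEStronglyMeasurable (fun t => ⟪s t, s' t⟫_ℂ) μ := by
  have hn : ∀ c : ℂ, AEStronglyMeasurable (fun t => ((‖s t + c • s' t‖ : ℝ) : ℂ) ^ 2) μ :=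
    fun c => (Complex.continuous_ofReal.comp_aestronglyMeasurable (h.add (h'.smul c)).norm).pow 2
  have e : ∀ t, ⟪s t, s' t⟫_ℂ = (((‖s t + (1 : ℂ) • s' t‖ : ℝ) : ℂ) ^ 2
      - ((‖s t + (-1 : ℂ) • s' t‖ : ℝ) : ℂ) ^ 2
      + (((‖s t + (-Complex.I) • s' t‖ : ℝ) : ℂ) ^ 2
      - ((‖s t + Complex.I • s' t‖ : ℝ) : ℂ) ^ 2) * Complex.I) * (1 / 4) := by
    intro t
    rw [inner_eq_sum_norm_sq_div_four (s t) (s' t)]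
    simp only [one_smul, neg_smul, ← sub_eq_add_neg]
    simp
    ring
  simp only [e]
  exact ((((hn 1).sub (hn (-1))).add (((hn (-Complex.I)).sub (hn Complex.I)).mul_const _))).mul_const _

/-- The measurable square-integrable sections. -/
def sqIntegrable : Submodule ℂ (∀ t, 𝓗 t) where
  carrier := {s | F.IsMeasurableSection s ∧ MemLp (fun t => ‖s t‖) 2 μ}
  add_mem' := by
    rintro s s' ⟨h, hL⟩ ⟨h', hL'⟩
    refine ⟨h.add h', (hL.add hL').mono (h.add h').norm (ae_of_all _ fun t => ?_)⟩
    simp only [Pi.add_apply, norm_norm]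
    exact (norm_add_le _ _).trans (le_abs_self _)
  zero_mem' := ⟨fun i => by simpa using aestronglyMeasurable_const, by simp⟩
  smul_mem' := by
    rintro c s ⟨h, hL⟩
    refine ⟨h.smul c, (hL.const_mul ‖c‖).congr_norm (h.smul c).norm (ae_of_all _ fun t => ?_)⟩
    simp [norm_smul]

/-- The measurable square-integrable sections, with the semidefinite inner product
`∫ (s(t), s'(t)) dμ(t)`. -/
def PreDirectIntegral : Type _ := F.sqIntegrable

instance : AddCommGroup F.PreDirectIntegral := inferInstanceAs (AddCommGroup F.sqIntegrable)

instance : Module ℂ F.PreDirectIntegral := inferInstanceAs (Module ℂ F.sqIntegrable)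

/-- A square-integrable section as an element of the pre-Hilbert space. -/
def toPre : F.sqIntegrable ≃ₗ[ℂ] F.PreDirectIntegral := LinearEquiv.refl ℂ _

lemma integrable_inner (s s' : F.sqIntegrable) :
    Integrable (fun t => ⟪s.1 t, s'.1 t⟫_ℂ) μ := by
  refine (s.2.2.integrable_mul s'.2.2).mono (s.2.1.inner s'.2.1) (ae_of_all _ fun t => ?_)
  simpa using norm_inner_le_norm (𝕜 := ℂ) (s.1 t) (s'.1 t)

/-- The inner product `∫ (s(t), s'(t)) dμ(t)` of square-integrable sections. -/
@[reducible] def preCore : PreInnerProductSpace.Core ℂ F.PreDirectIntegral where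
  inner s s' := ∫ t, ⟪(F.toPre.symm s).1 t, (F.toPre.symm s').1 t⟫_ℂ ∂μ
  conj_inner_symm s s' := by
    rw [← integral_conj]
    simp only [inner_conj_symm]
  re_inner_nonneg s := by
    rw [← integral_re (F.integrable_inner _ _)]
    exact integral_nonneg fun t => inner_self_nonneg
  add_left s s' s'' := by
    rw [← integral_add (F.integrable_inner _ _) (F.integrable_inner _ _)]
    simp
  smul_left s s' c := by
    rw [← integral_const_mul]
    simp [mul_comm]

instance : SeminormedAddCommGroup F.PreDirectIntegral :=
  @InnerProductSpace.Core.toSeminormedAddCommGroup ℂ _ _ _ _ F.preCore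

instance : InnerProductSpace ℂ F.PreDirectIntegral := InnerProductSpace.ofCore F.preCore

/-- The direct integral `∫⊕ 𝓗 t dμ(t)`: the measurable square-integrable sections, modulo the
sections of norm zero, that is, modulo equality almost everywhere. -/
abbrev DirectIntegral : Type _ := SeparationQuotient F.PreDirectIntegral

/-- The class of a square-integrable section in the direct integral. -/
def toClass (s : ∀ t, 𝓗 t) (hs : s ∈ F.sqIntegrable) : F.DirectIntegral :=
  SeparationQuotient.mk (F.toPre ⟨s, hs⟩)

lemma inner_toClass (s s' : ∀ t, 𝓗 t) (hs : s ∈ F.sqIntegrable) (hs' : s' ∈ F.sqIntegrable) :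
    ⟪F.toClass s hs, F.toClass s' hs'⟫_ℂ = ∫ t, ⟪s t, s' t⟫_ℂ ∂μ :=
  SeparationQuotient.inner_mk_mk _ _

lemma toClass_eq_iff (s s' : ∀ t, 𝓗 t) (hs : s ∈ F.sqIntegrable) (hs' : s' ∈ F.sqIntegrable) :
    F.toClass s hs = F.toClass s' hs' ↔ ∀ᵐ t ∂μ, s t = s' t := by
  have hd : s - s' ∈ F.sqIntegrable := F.sqIntegrable.sub_mem hs hs'
  have e : F.toClass s hs - F.toClass s' hs' = F.toClass (s - s') hd := by
    unfold toClass
    rw [← SeparationQuotient.mk_sub, ← map_sub]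
    rfl
  have hi : Integrable (fun t => ‖(s - s') t‖ ^ 2) μ := hd.2.integrable_sq
  have e2 : (∫ t, ⟪(s - s') t, (s - s') t⟫_ℂ ∂μ) = ((∫ t, ‖(s - s') t‖ ^ 2 ∂μ : ℝ) : ℂ) := by
    rw [← integral_complex_ofReal]
    refine integral_congr_ae (ae_of_all _ fun t => ?_)
    simp [inner_self_eq_norm_sq_to_K]
  rw [← sub_eq_zero, e, ← inner_self_eq_zero (𝕜 := ℂ), inner_toClass, e2, Complex.ofReal_eq_zero,
    integral_eq_zero_iff_of_nonneg (fun t => by positivity) hi]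
  refine eventually_congr (ae_of_all _ fun t => ?_)
  simp [sub_eq_zero]

end MeasurableField
end DirectIntegral

section Fibre

variable (T : H →L[ℂ] H) (hT : LinearMap.ker (T : H →ₗ[ℂ] H) = ⊥)

/-- The domain `D(T⁻¹)`, that is, the range of `T`. -/
abbrev dom : Submodule ℂ H := LinearMap.range (T : H →ₗ[ℂ] H)

/-- The inverse `T⁻¹ : D(T⁻¹) → H` of an injective operator `T`. -/
def inv : dom T →ₗ[ℂ] H :=
  (LinearEquiv.ofInjective (T : H →ₗ[ℂ] H) (LinearMap.ker_eq_bot.1 hT)).symm.toLinearMap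

lemma inv_apply (y : H) (hy : T y ∈ dom T) : inv T hT ⟨T y, hy⟩ = y :=
  (LinearEquiv.ofInjective (T : H →ₗ[ℂ] H) (LinearMap.ker_eq_bot.1 hT)).symm_apply_apply y

/-- The operator `A^{1/2} T⁻¹ : D(T⁻¹) → H`. -/
def weight (A : H →L[ℂ] H) : dom T →ₗ[ℂ] H :=
  (CFC.sqrt A : H →L[ℂ] H).toLinearMap ∘ₗ inv T hT

/-- `D(T⁻¹)` with the seminorm `h ↦ ‖A^{1/2} T⁻¹ h‖`. -/
def PreFibre (_hT : LinearMap.ker (T : H →ₗ[ℂ] H) = ⊥) (_A : H →L[ℂ] H) : Type _ := dom T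

variable (A : H →L[ℂ] H)

instance : AddCommGroup (PreFibre T hT A) := inferInstanceAs (AddCommGroup (dom T))

instance : Module ℂ (PreFibre T hT A) := inferInstanceAs (Module ℂ (dom T))

/-- An element of `D(T⁻¹)` as an element of the seminormed space. -/
def toPreFibre : dom T ≃ₗ[ℂ] PreFibre T hT A := LinearEquiv.refl ℂ _

/-- The operator `A^{1/2} T⁻¹` on the seminormed space that it defines. -/
def preWeight : PreFibre T hT A →ₗ[ℂ] H := weight T hT A ∘ₗ (toPreFibre T hT A).symm.toLinearMap

instance : SeminormedAddCommGroup (PreFibre T hT A) :=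
  SeminormedAddCommGroup.induced _ _ (preWeight T hT A)

instance : InnerProductSpace ℂ (PreFibre T hT A) where
  norm_smul_le c x := by
    change ‖preWeight T hT A (c • x)‖ ≤ ‖c‖ * ‖preWeight T hT A x‖
    rw [map_smul, norm_smul]
  inner x y := ⟪preWeight T hT A x, preWeight T hT A y⟫_ℂ
  norm_sq_eq_re_inner x := norm_sq_eq_re_inner (𝕜 := ℂ) (preWeight T hT A x)
  conj_inner_symm x y := inner_conj_symm _ _
  add_left x y z := by rw [map_add, inner_add_left]
  smul_left x y c := by rw [map_smul, inner_smul_left]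

lemma norm_toPreFibre (h : dom T) : ‖toPreFibre T hT A h‖ = ‖weight T hT A h‖ := rfl

lemma inner_toPreFibre (h k : dom T) :
    ⟪toPreFibre T hT A h, toPreFibre T hT A k⟫_ℂ = ⟪weight T hT A h, weight T hT A k⟫_ℂ := rfl

/-- The Hilbert space obtained from `D(T⁻¹)` with the seminorm `h ↦ ‖A^{1/2} T⁻¹ h‖` by
completing it and factoring out the vectors of norm zero. -/
abbrev Fibre : Type _ := UniformSpace.Completion (PreFibre T hT A)

/-- The canonical image in the fibre of an element of `D(T⁻¹)`. -/
def toFibre (h : dom T) : Fibre T hT A := (toPreFibre T hT A h : UniformSpace.Completion _)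

lemma inner_toFibre (h k : dom T) :
    ⟪toFibre T hT A h, toFibre T hT A k⟫_ℂ = ⟪weight T hT A h, weight T hT A k⟫_ℂ :=
  UniformSpace.Completion.inner_coe _ _

lemma inner_weight (hA : 0 ≤ A) (h k : dom T) :
    ⟪weight T hT A h, weight T hT A k⟫_ℂ = ⟪inv T hT h, A (inv T hT k)⟫_ℂ := by
  have h0 : (0 : H →L[ℂ] H) ≤ CFC.sqrt A := CFC.sqrt_nonneg A
  have hpos : (CFC.sqrt A : H →L[ℂ] H).IsPositive :=
    (ContinuousLinearMap.nonneg_iff_isPositive _).1 h0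
  have hs := CFC.sqrt_mul_sqrt_self A hA
  change ⟪CFC.sqrt A (inv T hT h), CFC.sqrt A (inv T hT k)⟫_ℂ = _
  rw [hpos.inner_left_eq_inner_right]
  change ⟪inv T hT h, (CFC.sqrt A * CFC.sqrt A) (inv T hT k)⟫_ℂ = _
  rw [hs]

lemma denseRange_toFibre [TopologicalSpace.SeparableSpace H] :
    DenseRange fun n : ℕ =>
      toFibre T hT A ⟨T (TopologicalSpace.denseSeq H n), LinearMap.mem_range_self _ _⟩ := by
  let G : H →ₗ[ℂ] PreFibre T hT A :=
    (toPreFibre T hT A).toLinearMap ∘ₗ (T : H →ₗ[ℂ] H).rangeRestrict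
  have hG : Continuous G := by
    refine AddMonoidHomClass.continuous_of_bound G ‖(CFC.sqrt A : H →L[ℂ] H)‖ fun y => ?_
    have : ‖G y‖ = ‖CFC.sqrt A y‖ := by
      change ‖CFC.sqrt A (inv T hT ⟨T y, _⟩)‖ = _
      rw [inv_apply]
    rw [this]
    exact ContinuousLinearMap.le_opNorm _ _
  have hsurj : Function.Surjective G :=
    (toPreFibre T hT A).surjective.comp (LinearMap.surjective_rangeRestrict _)
  exact (UniformSpace.Completion.denseRange_coe.comp
    (hsurj.denseRange.comp (TopologicalSpace.denseRange_denseSeq H) hG)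
    (UniformSpace.Completion.continuous_coe _))

end Fibre

section BGK

variable [TopologicalSpace.SeparableSpace H] {S : Distribution H} {T : H →L[ℂ] H}
  (hT : LinearMap.ker (T : H →ₗ[ℂ] H) = ⊥) {ρ : Measure ℝ} {Ψ : ℝ → H →L[ℂ] H}

/-- The measurable field of the Hilbert spaces `𝔥_t` determined by `T` and the density `Ψ`; its
fundamental family consists of the constant sections `t ↦ h`, `h ∈ D(T⁻¹)`. -/
def bgkField (hΨ : IsBGKDensity S T ρ Ψ) :
    MeasurableField ρ (fun t => Fibre T hT (Ψ t)) (dom T) where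
  e h t := toFibre T hT (Ψ t) h
  measurable_inner h k := by
    refine (hΨ.aestronglyMeasurable (inv T hT h) (inv T hT k)).congr ?_
    filter_upwards [hΨ.nonneg] with t ht
    rw [inner_toFibre, inner_weight T hT _ ht]
  exists_total := ⟨fun n => ⟨T (TopologicalSpace.denseSeq H n), LinearMap.mem_range_self _ _⟩,
    ae_of_all _ fun t => (denseRange_toFibre T hT (Ψ t)).mono Submodule.subset_span⟩

/-- The direct integral `∫⊕ 𝔥_t dρ(t)`. -/
abbrev BGKIntegral (hΨ : IsBGKDensity S T ρ Ψ) : Type _ := (bgkField hT hΨ).DirectIntegral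

/-- A linear isometry of `L₂(Σ, H)` onto `∫⊕ 𝔥_t dρ(t)` is the canonical identification if it
takes (the class of) each function `f` in `C₀₀(H)` with values in `D(T⁻¹)` to (the class of) the
section `t ↦ f(t)`. -/
def IsCanonical {hΨ : IsBGKDensity S T ρ Ψ} (U : S.L2 ≃ₗᵢ[ℂ] BGKIntegral hT hΨ) : Prop :=
  ∀ (f : C00 H) (hf : ∀ t, f.1 t ∈ dom T),
    ∃ hs : (fun t => toFibre T hT (Ψ t) ⟨f.1 t, hf t⟩) ∈ (bgkField hT hΨ).sqIntegrable,
      U (S.toL2 f) = (bgkField hT hΨ).toClass _ hs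

end BGK

end OpMeasure

end

noncomputable section

open MeasureTheory Filter Topology Set
open scoped InnerProductSpace ENNReal

namespace OpMeasure

/-! ### Localization to bounded Borel sets -/

section BoundedSets

variable {ρ : Measure ℝ}

/-! For fixed `u`, `v` the complex measure `(Σ(·)v, u)` is a polarization of four scalar measures,
each absolutely continuous with respect to `ρ`, so it has a density `polarDensity ρ u v`. In general
these densities do not assemble into an operator: each is defined up to a null set depending on `u`,
`v`, and no bound in terms of `‖u‖ ‖v‖` need hold at a given `t`.

The Hilbert–Schmidt operator repairs this. Take an orthonormal basis `b` with `∑ ‖T bᵢ‖² < ∞`; it is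
countable because `T` is injective. The density `τᵢ` of `(Σ(·)T bᵢ, T bᵢ)` has integral at most
`‖Σ(Δ)‖ ‖T bᵢ‖²` over a bounded `Δ`, so `∑ τᵢ(t) < ∞` almost everywhere (`ae_summable_density`). By
the Cauchy–Schwarz inequality for densities (`ae_norm_polarDensity_le`), the matrix of the densities
of `(Σ(·)T bⱼ, T bᵢ)` is bounded entrywise by `√τᵢ √τⱼ`, and such a matrix defines a bounded
operator `Ψ(t)` (`exists_hasSum_inner_apply`). Termwise integration shows that `Ψ` is the weak
density of `T*ΣT`; the trace of `Ψ(t)` is `∑ τᵢ(t)`.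

For the isometry, consider the two maps that send `g` in `C₀₀(H)` to the class of `t ↦ T g(t)` in
`L₂(Σ, H)` and in the direct integral. Both classes have squared norm `∫ (Ψ(t)g(t), g(t)) dρ(t)`: in
`L₂(Σ, H)` by passing from Riemann sums to integrals (`inner_toL2_map`), in the direct integral by
the definition of the fibres. Both maps have dense range. In `L₂(Σ, H)` this follows from the
density of `ran T`, that is, from `ker T* = 0`; in the direct integral, a section orthogonal to all
`φ(t) T x` vanishes almost everywhere. Since the direct integral is complete (Riesz–Fischer), the
correspondence extends to a unique isometry onto.

Every function of `C₀₀(H)` with values in `ran T` has the form `T g` (`C00.exists_map_eq`), so the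
canonical property prescribes the isometry exactly on this dense set. Independence of `T` then
follows with `V = U₂ U₁⁻¹`. -/

lemma ae_of_forall_ae_restrict_Ioo {p : ℝ → Prop}
    (h : ∀ n : ℕ, ∀ᵐ t ∂ρ.restrict (Ioo (-(n : ℝ)) n), p t) : ∀ᵐ t ∂ρ, p t := by
  have h2 := (ae_restrict_iUnion_iff (μ := ρ) (fun n : ℕ => Ioo (-(n : ℝ)) n) p).2 h
  have h3 : ⋃ n : ℕ, Ioo (-(n : ℝ)) n = univ := by
    refine eq_univ_of_forall fun t => mem_iUnion.2 ?_
    obtain ⟨n, hn⟩ := exists_nat_gt |t|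
    exact ⟨n, abs_lt.1 hn⟩
  rwa [h3, Measure.restrict_univ] at h2

/-- The functions to be compared are integrable over bounded sets only, so the criterion for
integrable functions is applied on each `(-n, n)`. -/
lemma ae_eq_of_setIntegral_eq_of_isBounded {f g : ℝ → ℂ}
    (hf : ∀ Δ, MeasurableSet Δ → Bornology.IsBounded Δ → IntegrableOn f Δ ρ)
    (hg : ∀ Δ, MeasurableSet Δ → Bornology.IsBounded Δ → IntegrableOn g Δ ρ)
    (h : ∀ Δ, MeasurableSet Δ → Bornology.IsBounded Δ →
      ∫ t in Δ, f t ∂ρ = ∫ t in Δ, g t ∂ρ) :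
    f =ᵐ[ρ] g := by
  refine ae_of_forall_ae_restrict_Ioo fun n => ?_
  refine Integrable.ae_eq_of_forall_setIntegral_eq _ _
    (hf _ measurableSet_Ioo (Metric.isBounded_Ioo _ _))
    (hg _ measurableSet_Ioo (Metric.isBounded_Ioo _ _)) fun s hs _ => ?_
  rw [Measure.restrict_restrict hs]
  exact h _ (hs.inter measurableSet_Ioo) ((Metric.isBounded_Ioo _ _).subset inter_subset_right)

/-- The integrability has to come from `f`: the measure `ρ` may be infinite on bounded sets, so a
continuous compactly supported function need not be integrable itself. -/
lemma integrable_mul_of_hasCompactSupport {φ f : ℝ → ℂ} (hφ : Continuous φ)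
    (hs : HasCompactSupport φ)
    (hf : ∀ Δ, MeasurableSet Δ → Bornology.IsBounded Δ → IntegrableOn f Δ ρ) :
    Integrable (fun t => φ t * f t) ρ := by
  have hK : IsCompact (tsupport φ) := hs
  have h1 : IntegrableOn (fun t => φ t * f t) (tsupport φ) ρ := by
    obtain ⟨C, hC⟩ := hs.exists_bound_of_continuous hφ
    exact (hf _ hK.measurableSet hK.isBounded).bdd_mul
      hφ.aestronglyMeasurable (ae_of_all _ hC)
  refine (integrableOn_iff_integrable_of_support_subset ?_).1 h1
  intro t ht
  exact subset_tsupport φ fun h0 => ht (by simp [h0])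

end BoundedSets

/-! ### Elementary functions in `C₀₀(H)` and lifting along `T` -/

namespace C00

variable {H : Type*} [NormedAddCommGroup H] [InnerProductSpace ℂ H]

/-- The function `t ↦ φ(t) u`. -/
def single (φ : ℝ → ℂ) (hφ : Continuous φ) (hs : HasCompactSupport φ) (u : H) : C00 H :=
  ⟨fun t => φ t • u, hφ.smul continuous_const, hs.smul_right (f' := fun _ => u),
    Submodule.span ℂ {u}, inferInstance,
    fun _ => Submodule.smul_mem _ _ (Submodule.mem_span_singleton_self u)⟩

/-- The composition with a bounded operator. -/
def map (T : H →L[ℂ] H) : C00 H →ₗ[ℂ] C00 H where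
  toFun g := ⟨fun t => T (g.1 t), T.continuous.comp g.2.1,
    g.2.2.1.comp_left (map_zero T), by
      obtain ⟨F, hF, h⟩ := g.2.2.2
      exact ⟨F.map (T : H →ₗ[ℂ] H), inferInstance, fun t => Submodule.mem_map_of_mem (h t)⟩⟩
  map_add' f g := Subtype.ext (funext fun t => map_add T (f.1 t) (g.1 t))
  map_smul' c f := Subtype.ext (funext fun t => map_smul T c (f.1 t))

lemma map_single (T : H →L[ℂ] H) (φ : ℝ → ℂ) (hφ : Continuous φ) (hs : HasCompactSupport φ)
    (u : H) : map T (single φ hφ hs u) = single φ hφ hs (T u) :=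
  Subtype.ext (funext fun t => map_smul T (φ t) u)

lemma exists_eq_sum_single (f : C00 H) :
    ∃ (n : ℕ) (φ : Fin n → ℝ → ℂ) (hφ : ∀ i, Continuous (φ i))
      (hs : ∀ i, HasCompactSupport (φ i)) (u : Fin n → H),
      f = ∑ i, single (φ i) (hφ i) (hs i) (u i) := by
  obtain ⟨n, φ, u, hφ, hs, h⟩ := exists_sum_of_mem_C00 f
  refine ⟨n, φ, hφ, hs, u, Subtype.ext (funext fun t => ?_)⟩
  rw [h, Submodule.coe_sum, Finset.sum_apply]
  rfl

lemma inner_apply_sum_single (A : H →L[ℂ] H) {n m : ℕ} (φ : Fin n → ℝ → ℂ)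
    (ψ : Fin m → ℝ → ℂ) (hφ : ∀ i, Continuous (φ i)) (hφs : ∀ i, HasCompactSupport (φ i))
    (hψ : ∀ i, Continuous (ψ i)) (hψs : ∀ i, HasCompactSupport (ψ i)) (u : Fin n → H)
    (v : Fin m → H) (t : ℝ) :
    ⟪(∑ i, single (φ i) (hφ i) (hφs i) (u i) : C00 H).1 t,
      A ((∑ i, single (ψ i) (hψ i) (hψs i) (v i) : C00 H).1 t)⟫_ℂ
      = ∑ i, ∑ j, ((starRingEnd ℂ) (φ i t) * ψ j t) * ⟪u i, A (v j)⟫_ℂ := by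
  simp only [Submodule.coe_sum, Finset.sum_apply, single, map_sum, map_smul]
  rw [sum_inner]
  refine Finset.sum_congr rfl fun i _ => ?_
  rw [inner_sum]
  refine Finset.sum_congr rfl fun j _ => ?_
  rw [inner_smul_left, inner_smul_right]
  ring

/-- A function of `C₀₀(H)` with values in the range of an injective operator `T` lifts to
`C₀₀(H)` along `T`. -/
lemma exists_map_eq (T : H →L[ℂ] H) (hT : LinearMap.ker (T : H →ₗ[ℂ] H) = ⊥) (f : C00 H)
    (hf : ∀ t, f.1 t ∈ dom T) : ∃ g : C00 H, map T g = f := by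
  obtain ⟨hc, hs, F, hF, hfF⟩ := f.2
  let G : Submodule ℂ H := F.comap (T : H →ₗ[ℂ] H)
  let T' : G →ₗ[ℂ] F := (T : H →ₗ[ℂ] H).restrict fun x hx => hx
  have hinj : Function.Injective T' := by
    intro x y h
    exact Subtype.ext (LinearMap.ker_eq_bot.1 hT (congrArg Subtype.val h))
  have hG : FiniteDimensional ℂ G := Module.Finite.of_injective T' hinj
  -- `T⁻¹` may be unbounded on `ran T`, but only its restriction to a finite-dimensional space is
  -- needed, and there linearity gives continuity.
  obtain ⟨L, hL⟩ := T'.exists_leftInverse_of_injective (LinearMap.ker_eq_bot.2 hinj)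
  have hLc : Continuous L := L.continuous_of_finiteDimensional
  refine ⟨⟨fun t => (L ⟨f.1 t, hfF t⟩ : H), ?_, ?_, G, hG, fun t => (L _).2⟩, ?_⟩
  · exact continuous_subtype_val.comp (hLc.comp (hc.subtype_mk _))
  · refine hs.mono fun t ht => ?_
    rw [Function.mem_support] at ht ⊢
    intro h0
    apply ht
    have : (⟨f.1 t, hfF t⟩ : F) = 0 := Subtype.ext h0
    simp [this]
  · refine Subtype.ext (funext fun t => ?_)
    obtain ⟨y, hy⟩ := hf t
    have hyG : y ∈ G := by
      change T y ∈ F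
      exact hy ▸ hfF t
    have e : (⟨f.1 t, hfF t⟩ : F) = T' ⟨y, hyG⟩ := Subtype.ext hy.symm
    change T (L ⟨f.1 t, hfF t⟩ : H) = f.1 t
    rw [e]
    have := LinearMap.congr_fun hL ⟨y, hyG⟩
    simp only [LinearMap.comp_apply, LinearMap.id_apply] at this
    rw [this]
    exact hy

end C00

variable {H : Type*} [NormedAddCommGroup H] [InnerProductSpace ℂ H] [CompleteSpace H]

/-! ### Radon–Nikodym densities of the scalar measures of `Σ` -/

namespace Distribution

variable (S : Distribution H)

lemma inner_opMeasure_eq_polar {Δ : Set ℝ} (hm : MeasurableSet Δ) (hb : Bornology.IsBounded Δ)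
    (x y : H) : ⟪x, S.opMeasure Δ y⟫_ℂ = S.polar Δ x y := by
  rw [← inner_polarization (S.opMeasure Δ) x y, polar]
  simp_rw [S.inner_opMeasure hm hb]

lemma scalarMeasure_real_le {Δ : Set ℝ} (hm : MeasurableSet Δ) (hb : Bornology.IsBounded Δ)
    (x : H) : (S.scalarMeasure x).real Δ ≤ ‖S.opMeasure Δ‖ * ‖x‖ ^ 2 := by
  have h := S.inner_opMeasure hm hb x
  calc (S.scalarMeasure x).real Δ ≤ ‖(((S.scalarMeasure x).real Δ : ℝ) : ℂ)‖ := by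
        rw [Complex.norm_real]; exact le_abs_self _
    _ ≤ ‖x‖ * (‖S.opMeasure Δ‖ * ‖x‖) := by
        rw [← h]
        exact (norm_inner_le_norm _ _).trans
          (by gcongr; exact ContinuousLinearMap.le_opNorm _ _)
    _ = _ := by ring

/-- Equivalence compares null sets among bounded sets only, so a `ρ`-null set is exhausted by its
intersections with `(-n, n)`. On each of them `Σ` vanishes, hence so does `(Σ(·)x, x)`. -/
lemma Equivalent.absolutelyContinuous {S : Distribution H} {ρ : Measure ℝ} (hρ : S.Equivalent ρ)
    (x : H) : S.scalarMeasure x ≪ ρ := by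
  refine Measure.AbsolutelyContinuous.mk fun Δ hΔ h0 => ?_
  have h1 : ∀ n : ℕ, S.scalarMeasure x (Δ ∩ Ioo (-(n : ℝ)) n) = 0 := by
    intro n
    have hm : MeasurableSet (Δ ∩ Ioo (-(n : ℝ)) n) := hΔ.inter measurableSet_Ioo
    have hb : Bornology.IsBounded (Δ ∩ Ioo (-(n : ℝ)) n) :=
      (Metric.isBounded_Ioo _ _).subset inter_subset_right
    have hz := (hρ _ hm hb).1 (measure_mono_null inter_subset_left h0)
    have := S.inner_opMeasure hm hb x
    rw [hz] at this
    simp only [_root_.zero_apply, inner_zero_right] at this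
    have h2 : (S.scalarMeasure x).real (Δ ∩ Ioo (-(n : ℝ)) n) = 0 := by exact_mod_cast this.symm
    exact (measureReal_eq_zero_iff (S.scalarMeasure_ne_top x hb)).1 h2
  have h3 : Δ = ⋃ n : ℕ, Δ ∩ Ioo (-(n : ℝ)) n := by
    rw [← inter_iUnion]
    refine (inter_eq_left.2 fun t _ => mem_iUnion.2 ?_).symm
    obtain ⟨n, hn⟩ := exists_nat_gt |t|
    exact ⟨n, abs_lt.1 hn⟩
  rw [h3]
  exact measure_iUnion_null h1

/-- The Radon-Nikodym density of the scalar measure `(Σ(·)v, v)` with respect to `ρ`. -/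
def density (ρ : Measure ℝ) (v : H) (t : ℝ) : ℝ := ((S.scalarMeasure v).rnDeriv ρ t).toReal

/-- The density of the complex measure `(Σ(·)v, u)`, by polarization. -/
def polarDensity (ρ : Measure ℝ) (u v : H) (t : ℝ) : ℂ :=
  ∑ k : Fin 4, (![1, -1, -Complex.I, Complex.I] k / 4) *
    (S.density ρ (![u + v, u - v, u + Complex.I • v, u - Complex.I • v] k) t : ℂ)

variable {S} {ρ : Measure ℝ}

lemma integrableOn_polarDensity (u v : H) {Δ : Set ℝ}
    (hb : Bornology.IsBounded Δ) : IntegrableOn (S.polarDensity ρ u v) Δ ρ := by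
  unfold polarDensity
  refine integrable_finsetSum _ fun k _ => Integrable.const_mul ?_ _
  exact (Measure.integrableOn_toReal_rnDeriv (S.scalarMeasure_ne_top _ hb)).ofReal

lemma setIntegral_polarDensity [SigmaFinite ρ] (hρ : S.Equivalent ρ) (u v : H) {Δ : Set ℝ}
    (hm : MeasurableSet Δ) (hb : Bornology.IsBounded Δ) :
    ∫ t in Δ, S.polarDensity ρ u v t ∂ρ = ⟪u, S.opMeasure Δ v⟫_ℂ := by
  rw [S.inner_opMeasure_eq_polar hm hb]
  unfold polarDensity polar
  rw [integral_finsetSum _ fun k _ => Integrable.const_mul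
    (Measure.integrableOn_toReal_rnDeriv (S.scalarMeasure_ne_top _ hb)).ofReal _]
  refine Finset.sum_congr rfl fun k _ => ?_
  rw [integral_const_mul]
  congr 1
  unfold density
  rw [integral_complex_ofReal, Measure.setIntegral_toReal_rnDeriv (hρ.absolutelyContinuous _)]

/-- The bridge from Riemann sums to `ρ`: the sums converge to integrals against the four scalar
measures of the polarization. -/
lemma integral_mul_polarDensity [SigmaFinite ρ] (hρ : S.Equivalent ρ) (u v : H) {h : ℝ → ℂ}
    (hc : Continuous h) (hs : HasCompactSupport h) :
    ∫ t, h t * S.polarDensity ρ u v t ∂ρ = ∑ k : Fin 4, (![1, -1, -Complex.I, Complex.I] k / 4) *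
      ∫ t, h t ∂(S.scalarMeasure (![u + v, u - v, u + Complex.I • v, u - Complex.I • v] k)) := by
  have hi : ∀ w : H, Integrable (fun t => h t * (S.density ρ w t : ℂ)) ρ := fun w =>
    integrable_mul_of_hasCompactSupport hc hs fun Δ _ hb =>
      (Measure.integrableOn_toReal_rnDeriv (S.scalarMeasure_ne_top w hb)).ofReal
  simp only [polarDensity, Finset.mul_sum]
  rw [integral_finsetSum]
  · refine Finset.sum_congr rfl fun k _ => ?_
    rw [← integral_rnDeriv_smul (hρ.absolutelyContinuous _), ← integral_const_mul]
    refine integral_congr_ae (ae_of_all _ fun t => ?_)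
    simp only [density, Complex.real_smul]
    ring
  · intro k _
    refine ((hi (![u + v, u - v, u + Complex.I • v, u - Complex.I • v] k)).const_mul
      (![1, -1, -Complex.I, Complex.I] k / 4)).congr
      (ae_of_all _ fun t => ?_)
    simp only
    ring

end Distribution

/-! ### The inner product of `L₂(Σ, H)` as an integral over `ρ` -/

namespace Distribution

variable {S : Distribution H} {ρ : Measure ℝ} [SigmaFinite ρ]

/-- Polarization of each increment splits the Riemann sum into four scalar Riemann sums of the same
function, and each of these converges. -/
lemma form_single (hρ : S.Equivalent ρ) {φ ψ : ℝ → ℂ} (hφ : Continuous φ)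
    (hφs : HasCompactSupport φ) (hψ : Continuous ψ) (hψs : HasCompactSupport ψ) (u v : H) :
    S.form (C00.single φ hφ hφs u).1 (C00.single ψ hψ hψs v).1
      = ∫ t, ((starRingEnd ℂ) (φ t) * ψ t) * S.polarDensity ρ u v t ∂ρ := by
  apply S.form_unique
  have hc : Continuous fun t => (starRingEnd ℂ) (φ t) * ψ t :=
    (Complex.continuous_conj.comp hφ).mul hψ
  have hs : HasCompactSupport fun t => (starRingEnd ℂ) (φ t) * ψ t := hψs.mul_left
  rw [integral_mul_polarDensity hρ u v hc hs]
  refine (tendsto_finsetSum _ fun k _ => Tendsto.const_mul _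
    (TaggedPartition.tendsto_sum_integral _ _ hc hs)).congr fun P => ?_
  rw [riemannSum]
  simp_rw [Finset.mul_sum]
  rw [Finset.sum_comm]
  refine Finset.sum_congr rfl fun k _ => ?_
  simp only [C00.single]
  rw [map_smul, inner_smul_left, inner_smul_right,
    ← S.polar_Ico (P.mono (Nat.le_succ k)), polar, Finset.mul_sum, Finset.mul_sum]
  refine Finset.sum_congr rfl fun l _ => ?_
  ring

variable (S) in
lemma inner_toL2_sum_single {n m : ℕ} (f : Fin n → C00 H) (g : Fin m → C00 H) :
    ⟪S.toL2 (∑ i, f i), S.toL2 (∑ j, g j)⟫_ℂ = ∑ i, ∑ j, S.form (f i).1 (g j).1 := by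
  have h : ∀ {n : ℕ} (f : Fin n → C00 H), S.toL2 (∑ i, f i) = ∑ i, S.toL2 (f i) := by
    intro n f
    unfold toL2
    rw [map_sum]
    exact map_sum (UniformSpace.Completion.toComplₗᵢ (𝕜 := ℂ) (E := S.PreL2)) _ _
  simp_rw [h, sum_inner, inner_sum, inner_toL2]

end Distribution

section Density

variable {S : Distribution H} {T : H →L[ℂ] H} {ρ : Measure ℝ} {Ψ : ℝ → H →L[ℂ] H}

/-- Both functions have the integral `(Σ(Δ)T y, T x)` over every bounded Borel set `Δ`. The
exceptional null set depends on `x` and `y`. -/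
lemma IsBGKDensity.ae_eq_polarDensity [SigmaFinite ρ] (hΨ : IsBGKDensity S T ρ Ψ)
    (hρ : S.Equivalent ρ) (x y : H) :
    (fun t => ⟪x, Ψ t y⟫_ℂ) =ᵐ[ρ] S.polarDensity ρ (T x) (T y) := by
  refine ae_eq_of_setIntegral_eq_of_isBounded (fun Δ hm hb => hΨ.integrableOn Δ hm hb x y)
    (fun Δ hm hb => Distribution.integrableOn_polarDensity _ _ hb) fun Δ hm hb => ?_
  rw [← hΨ.setIntegral_eq Δ hm hb, Distribution.setIntegral_polarDensity hρ _ _ hm hb]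
  simp [ContinuousLinearMap.adjoint_inner_right]

lemma IsBGKDensity.integrable_inner_apply (hΨ : IsBGKDensity S T ρ Ψ) (g g' : C00 H) :
    Integrable (fun t => ⟪g.1 t, Ψ t (g'.1 t)⟫_ℂ) ρ := by
  obtain ⟨n, φ, hφ, hφs, u, rfl⟩ := C00.exists_eq_sum_single g
  obtain ⟨m, ψ, hψ, hψs, v, rfl⟩ := C00.exists_eq_sum_single g'
  simp_rw [C00.inner_apply_sum_single]
  exact integrable_finsetSum _ fun i _ => integrable_finsetSum _ fun j _ =>
    integrable_mul_of_hasCompactSupport ((Complex.continuous_conj.comp (hφ i)).mul (hψ j))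
      (hψs j).mul_left fun Δ hm hb => hΨ.integrableOn Δ hm hb _ _

/-- The inner product of `L₂(Σ, H)` through the density of `T*ΣT`. -/
lemma IsBGKDensity.inner_toL2_map [SigmaFinite ρ] (hΨ : IsBGKDensity S T ρ Ψ)
    (hρ : S.Equivalent ρ) (g g' : C00 H) :
    ⟪S.toL2 (C00.map T g), S.toL2 (C00.map T g')⟫_ℂ = ∫ t, ⟪g.1 t, Ψ t (g'.1 t)⟫_ℂ ∂ρ := by
  obtain ⟨n, φ, hφ, hφs, u, rfl⟩ := C00.exists_eq_sum_single g
  obtain ⟨m, ψ, hψ, hψs, v, rfl⟩ := C00.exists_eq_sum_single g'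
  have hi : ∀ i j, Integrable
      (fun t => ((starRingEnd ℂ) (φ i t) * ψ j t) * ⟪u i, Ψ t (v j)⟫_ℂ) ρ := fun i j =>
    integrable_mul_of_hasCompactSupport ((Complex.continuous_conj.comp (hφ i)).mul (hψ j))
      (hψs j).mul_left fun Δ hm hb => hΨ.integrableOn Δ hm hb _ _
  simp_rw [C00.inner_apply_sum_single, map_sum, C00.map_single]
  rw [Distribution.inner_toL2_sum_single,
    integral_finsetSum _ fun i _ => integrable_finsetSum _ fun j _ => hi i j]
  refine Finset.sum_congr rfl fun i _ => ?_
  rw [integral_finsetSum _ fun j _ => hi i j]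
  refine Finset.sum_congr rfl fun j _ => ?_
  rw [Distribution.form_single hρ]
  refine integral_congr_ae ?_
  filter_upwards [hΨ.ae_eq_polarDensity hρ (u i) (v j)] with t ht
  rw [← ht]

end Density

/-! ### Completeness of the direct integral -/

lemma coeFn_sum_range_Lp {α : Type*} [MeasurableSpace α] {μ : Measure α} (f : ℕ → Lp ℝ 2 μ)
    (m : ℕ) : (∑ n ∈ Finset.range m, f n : Lp ℝ 2 μ) =ᵐ[μ]
      fun t => ∑ n ∈ Finset.range m, f n t := by
  induction m with
  | zero =>
    filter_upwards [Lp.coeFn_zero ℝ 2 μ] with t ht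
    simpa using ht
  | succ m ih =>
    rw [Finset.sum_range_succ]
    filter_upwards [ih, Lp.coeFn_add (∑ n ∈ Finset.range m, f n) (f m)] with t h1 h2
    rw [h2, Pi.add_apply, h1, Finset.sum_range_succ]

namespace MeasurableField

variable {α : Type*} [MeasurableSpace α] {μ : Measure α} {𝓗 : α → Type*}
  [∀ t, NormedAddCommGroup (𝓗 t)] [∀ t, InnerProductSpace ℂ (𝓗 t)] {ι : Type*}
  (F : MeasurableField μ 𝓗 ι)

/-- The class map, as a linear map. -/
def toClassₗ : F.sqIntegrable →ₗ[ℂ] F.DirectIntegral :=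
  (SeparationQuotient.mkCLM ℂ F.PreDirectIntegral).toLinearMap ∘ₗ F.toPre.toLinearMap

lemma toClassₗ_apply (s : F.sqIntegrable) : F.toClassₗ s = F.toClass s.1 s.2 := rfl

lemma toClassₗ_surjective : Function.Surjective F.toClassₗ :=
  SeparationQuotient.surjective_mk.comp F.toPre.surjective

lemma norm_sq_toClassₗ (s : F.sqIntegrable) : ‖F.toClassₗ s‖ ^ 2 = ∫ t, ‖s.1 t‖ ^ 2 ∂μ := by
  have h : ⟪F.toClassₗ s, F.toClassₗ s⟫_ℂ = ((∫ t, ‖s.1 t‖ ^ 2 ∂μ : ℝ) : ℂ) := by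
    rw [toClassₗ_apply, inner_toClass, ← integral_complex_ofReal]
    refine integral_congr_ae (ae_of_all _ fun t => ?_)
    simp [inner_self_eq_norm_sq_to_K]
  rw [inner_self_eq_norm_sq_to_K] at h
  exact Complex.ofReal_injective (by simpa using h)

/-- Moves norm estimates to the scalar space `Lp ℝ 2 μ` of pointwise norms, which is complete and
ordered. -/
lemma norm_toClassₗ (s : F.sqIntegrable) : ‖F.toClassₗ s‖ = ‖s.2.2.toLp‖ := by
  have h : ⟪s.2.2.toLp, s.2.2.toLp⟫_ℝ = ∫ t, ‖s.1 t‖ ^ 2 ∂μ := by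
    rw [L2.inner_def]
    refine integral_congr_ae ?_
    filter_upwards [s.2.2.coeFn_toLp] with t ht
    rw [ht]
    simp
  rw [real_inner_self_eq_norm_sq, ← norm_sq_toClassₗ] at h
  exact ((sq_eq_sq₀ (norm_nonneg _) (norm_nonneg _)).1 h).symm

lemma norm_toClassₗ_le (s : F.sqIntegrable) (g : Lp ℝ 2 μ) (h : ∀ᵐ t ∂μ, ‖s.1 t‖ ≤ g t) :
    ‖F.toClassₗ s‖ ≤ ‖g‖ := by
  rw [norm_toClassₗ]
  refine Lp.norm_le_norm_of_ae_le ?_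
  filter_upwards [h, s.2.2.coeFn_toLp] with t ht ht'
  rw [ht', norm_norm]
  exact ht.trans (le_abs_self _)

variable {F} in
lemma IsMeasurableSection.of_tendsto {s : ℕ → ∀ t, 𝓗 t} {s' : ∀ t, 𝓗 t}
    (h : ∀ n, F.IsMeasurableSection (s n))
    (hs : ∀ᵐ t ∂μ, Tendsto (fun n => s n t) atTop (𝓝 (s' t))) : F.IsMeasurableSection s' :=
  fun i => aestronglyMeasurable_of_tendsto_ae atTop (fun n => h n i)
    (hs.mono fun _ ht => tendsto_const_nhds.inner ht)

/-- The Riesz–Fischer argument. For an absolutely convergent series of classes, the pointwise norms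
`N n` form a convergent series in `Lp ℝ 2 μ`. Its tails `R k` dominate the tails of the pointwise
series almost everywhere, so the series converges in almost every fibre, and `‖R k‖ → 0` gives
convergence in norm. -/
instance completeSpace_directIntegral [∀ t, CompleteSpace (𝓗 t)] :
    CompleteSpace F.DirectIntegral := by
  refine NormedAddCommGroup.completeSpace_of_summable_imp_tendsto fun u hu => ?_
  choose s hs using fun n => F.toClassₗ_surjective (u n)
  set N : ℕ → Lp ℝ 2 μ := fun n => (s n).2.2.toLp with hN
  have hNs : Summable N := by
    refine Summable.of_norm (hu.congr fun n => ?_)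
    rw [← hs n, norm_toClassₗ]
  set R : ℕ → Lp ℝ 2 μ := fun k => ∑' n, N (n + k) with hR
  have hR0 : Tendsto R atTop (𝓝 0) := _root_.tendsto_sum_nat_add N
  have hNnn : ∀ n, 0 ≤ N n := by
    intro n
    rw [← Lp.coeFn_nonneg]
    filter_upwards [(s n).2.2.coeFn_toLp] with t ht
    simp only [hN, ht, Pi.zero_apply]
    exact norm_nonneg _
  -- Since the `N n` are nonnegative, finite sums lie below `R k` in the order of `Lp`, which is the
  -- order almost everywhere; countably many pairs `k`, `m` are involved.
  have hb : ∀ᵐ t ∂μ, ∀ k m, ∑ n ∈ Finset.range m, ‖(s (n + k)).1 t‖ ≤ R k t := by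
    refine ae_all_iff.2 fun k => ae_all_iff.2 fun m => ?_
    have hle : ∑ n ∈ Finset.range m, N (n + k) ≤ R k :=
      ((summable_nat_add_iff k).2 hNs).sum_le_tsum _ fun n _ => hNnn _
    have hc : ∀ᵐ t ∂μ, ∀ n, N n t = ‖(s n).1 t‖ :=
      ae_all_iff.2 fun n => (s n).2.2.coeFn_toLp
    filter_upwards [(Lp.coeFn_le _ _).2 hle, coeFn_sum_range_Lp (fun n => N (n + k)) m, hc]
      with t h1 h2 h3
    rw [h2] at h1
    simpa only [h3] using h1
  have hsum : ∀ᵐ t ∂μ, Summable fun n => (s n).1 t := by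
    filter_upwards [hb] with t ht
    exact Summable.of_norm (summable_of_sum_range_le (fun _ => norm_nonneg _) (ht 0))
  have htail : ∀ᵐ t ∂μ, ∀ k, ‖∑' n, (s (n + k)).1 t‖ ≤ R k t := by
    filter_upwards [hb] with t ht k
    exact (norm_tsum_le_tsum_norm
      (summable_of_sum_range_le (fun _ => norm_nonneg _) (ht k))).trans
      (Real.tsum_le_of_sum_range_le (fun _ => norm_nonneg _) (ht k))
  set σ : ∀ t, 𝓗 t := fun t => ∑' n, (s n).1 t with hσ
  have hpart : ∀ m t, (∑ n ∈ Finset.range m, s n : F.sqIntegrable).1 t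
      = ∑ n ∈ Finset.range m, (s n).1 t := fun m t => by
    rw [Submodule.coe_sum, Finset.sum_apply]
  have hσm : F.IsMeasurableSection σ :=
    IsMeasurableSection.of_tendsto (fun m => (∑ n ∈ Finset.range m, s n : F.sqIntegrable).2.1) (by
      filter_upwards [hsum] with t ht
      simp_rw [hpart]
      exact ht.hasSum.tendsto_sum_nat)
  have hσL : MemLp (fun t => ‖σ t‖) 2 μ := by
    refine (Lp.memLp (R 0)).mono hσm.norm ?_
    filter_upwards [htail] with t ht
    rw [norm_norm]
    exact (ht 0).trans (le_abs_self _)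
  refine ⟨F.toClassₗ ⟨σ, hσm, hσL⟩, ?_⟩
  rw [tendsto_iff_norm_sub_tendsto_zero]
  have hR0' : Tendsto (fun k => ‖R k‖) atTop (𝓝 0) := by simpa using hR0.norm
  refine squeeze_zero (fun _ => norm_nonneg _) (fun m => ?_) hR0'
  simp_rw [← hs]
  -- With the sign reversed, the section under the norm is the tail of the series from the index `m`
  -- on, which `R m` dominates.
  rw [← map_sum, ← map_sub, ← norm_neg, ← map_neg]
  refine F.norm_toClassₗ_le _ _ ?_
  filter_upwards [htail, hsum] with t ht hst
  have e : (-(∑ n ∈ Finset.range m, s n - ⟨σ, hσm, hσL⟩) : F.sqIntegrable).1 t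
      = ∑' n, (s (n + m)).1 t := by
    have := hst.sum_add_tsum_nat_add m
    rw [neg_sub]
    change σ t - (∑ n ∈ Finset.range m, s n : F.sqIntegrable).1 t = _
    rw [hpart, sub_eq_iff_eq_add', this]
  rw [e]
  exact ht m

end MeasurableField

/-! ### From matrix entries to operators -/

/-- Monotone convergence gives `∫ ‖f‖ ≤ ∑ ∫ ‖F i‖ < ∞`. The integrability of the sum is recorded
because it is part of the notion of a weak density. -/
lemma integrable_and_hasSum_integral_of_summable_integral_norm {α E ι : Type*}
    [MeasurableSpace α] {μ : Measure α} [NormedAddCommGroup E] [NormedSpace ℝ E] [Countable ι]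
    {F : ι → α → E} {f : α → E} (hF : ∀ i, Integrable (F i) μ)
    (hs : Summable fun i => ∫ a, ‖F i a‖ ∂μ) (hf : ∀ᵐ a ∂μ, HasSum (fun i => F i a) (f a)) :
    Integrable f μ ∧ HasSum (fun i => ∫ a, F i a ∂μ) (∫ a, f a ∂μ) := by
  have hf' : (fun a => ∑' i, F i a) =ᵐ[μ] f := hf.mono fun a ha => ha.tsum_eq
  refine ⟨⟨?_, ?_⟩, ?_⟩
  · exact aestronglyMeasurable_of_tendsto_ae atTop
      (fun s : Finset ι => Finset.aestronglyMeasurable_fun_sum s fun i _ => (hF i).1) hf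
  · rw [hasFiniteIntegral_iff_enorm]
    calc ∫⁻ a, ‖f a‖ₑ ∂μ ≤ ∫⁻ a, ∑' i, ‖F i a‖ₑ ∂μ := by
          refine lintegral_mono_ae (hf'.mono fun a ha => ?_)
          rw [← ha]
          exact enorm_tsum_le_tsum_enorm
      _ = ∑' i, ∫⁻ a, ‖F i a‖ₑ ∂μ := lintegral_tsum fun i => (hF i).1.enorm
      _ = ∑' i, ENNReal.ofReal (∫ a, ‖F i a‖ ∂μ) := by
          simp_rw [ofReal_integral_norm_eq_lintegral_enorm (hF _)]
      _ < ∞ := hs.tsum_ofReal_lt_top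
  · rw [← integral_congr_ae hf']
    exact hasSum_integral_of_summable_integral_norm hF hs

/-- Parseval's identity twice: over `j` for the pair `A* bᵢ`, `y`, then over `i` for the pair `x`,
`A y`. It serves to recognize `T*Σ(Δ)T` by its matrix after termwise integration. -/
lemma _root_.HilbertBasis.hasSum_inner_mul_apply_mul_inner {ι : Type*} (b : HilbertBasis ι ℂ H)
    (A : H →L[ℂ] H) (x y : H) {z : ℂ}
    (h : HasSum (fun p : ι × ι => ⟪x, b p.1⟫_ℂ * ⟪b p.1, A (b p.2)⟫_ℂ * ⟪b p.2, y⟫_ℂ) z) :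
    z = ⟪x, A y⟫_ℂ := by
  have h1 : ∀ i, HasSum (fun j => ⟪x, b i⟫_ℂ * ⟪b i, A (b j)⟫_ℂ * ⟪b j, y⟫_ℂ)
      (⟪x, b i⟫_ℂ * ⟪b i, A y⟫_ℂ) := fun i => by
    have := (b.hasSum_inner_mul_inner (A.adjoint (b i)) y).mul_left ⟪x, b i⟫_ℂ
    simpa only [ContinuousLinearMap.adjoint_inner_left, mul_assoc] using this
  exact (h.prod_fiberwise h1).unique (b.hasSum_inner_mul_inner x (A y))

/-- A matrix dominated by the square roots of a summable sequence is the matrix of a bounded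
operator. -/
lemma exists_hasSum_inner_apply {ι : Type*} (b : HilbertBasis ι ℂ H) (a : ι → ι → ℂ) (τ : ι → ℝ)
    (hτ : ∀ i, 0 ≤ τ i) (hs : Summable τ) (h : ∀ i j, ‖a i j‖ ≤ √(τ i) * √(τ j)) :
    ∃ A : H →L[ℂ] H, ∀ x y,
      HasSum (fun p : ι × ι => ⟪x, b p.1⟫_ℂ * a p.1 p.2 * ⟪b p.2, y⟫_ℂ) ⟪x, A y⟫_ℂ := by
  set r : H → ι → ℝ := fun x i => ‖⟪b i, x⟫_ℂ‖ * √(τ i) with hr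
  have hr0 : ∀ x i, 0 ≤ r x i := fun x i => by positivity
  -- Cauchy–Schwarz and Bessel. Since the terms of the double series are at most `r x i * r y j`,
  -- the form is bounded by `(∑ τᵢ) ‖x‖ ‖y‖`.
  have hrs : ∀ x, Summable (r x) ∧ ∑' i, r x i ≤ ‖x‖ * √(∑' i, τ i) := by
    intro x
    have hsq : ∀ i, √(τ i) ^ (2 : ℝ) = τ i := fun i => by
      rw [Real.rpow_two, Real.sq_sqrt (hτ i)]
    have hb := b.orthonormal.inner_products_summable (x := x)
    have := Real.summable_and_inner_le_Lp_mul_Lq_tsum_of_nonneg Real.HolderConjugate.two_two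
      (f := fun i => ‖⟪b i, x⟫_ℂ‖) (g := fun i => √(τ i)) (fun _ => norm_nonneg _)
      (fun _ => Real.sqrt_nonneg _) (by simpa only [Real.rpow_two] using hb)
      (by simpa only [hsq] using hs)
    refine ⟨this.1, this.2.trans ?_⟩
    simp only [hsq, Real.rpow_two, ← Real.sqrt_eq_rpow]
    gcongr
    rw [← Real.sqrt_sq (norm_nonneg x)]
    exact Real.sqrt_le_sqrt (b.orthonormal.tsum_inner_products_le x)
  have hle : ∀ x y (p : ι × ι), ‖⟪x, b p.1⟫_ℂ * a p.1 p.2 * ⟪b p.2, y⟫_ℂ‖ ≤ r x p.1 * r y p.2 := by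
    intro x y p
    rw [norm_mul, norm_mul, norm_inner_symm x]
    calc _ ≤ ‖⟪b p.1, x⟫_ℂ‖ * (√(τ p.1) * √(τ p.2)) * ‖⟪b p.2, y⟫_ℂ‖ := by
          gcongr
          exact h _ _
      _ = _ := by simp only [hr]; ring
  have hrr : ∀ x y, Summable fun p : ι × ι => r x p.1 * r y p.2 := fun x y =>
    (hrs x).1.mul_of_nonneg (hrs y).1 (hr0 x) (hr0 y)
  have hsum : ∀ x y, Summable fun p : ι × ι => ⟪x, b p.1⟫_ℂ * a p.1 p.2 * ⟪b p.2, y⟫_ℂ :=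
    fun x y => Summable.of_norm_bounded (hrr x y) (hle x y)
  let B : H →ₗ⋆[ℂ] H →ₗ[ℂ] ℂ := LinearMap.mk₂'ₛₗ (starRingEnd ℂ) (RingHom.id ℂ)
    (fun x y => ∑' p : ι × ι, ⟪x, b p.1⟫_ℂ * a p.1 p.2 * ⟪b p.2, y⟫_ℂ)
    (fun x x' y => by
      rw [← (hsum x y).tsum_add (hsum x' y)]
      simp only [inner_add_left, add_mul])
    (fun c x y => by
      rw [smul_eq_mul, ← tsum_mul_left]
      simp only [inner_smul_left, mul_assoc])
    (fun x y y' => by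
      rw [← (hsum x y).tsum_add (hsum x y')]
      simp only [inner_add_right, mul_add])
    (fun c x y => by
      rw [smul_eq_mul, ← tsum_mul_left]
      simp only [inner_smul_right, RingHom.id_apply]
      exact tsum_congr fun p => by ring)
  have hB : ∀ x y, ‖B x y‖ ≤ (∑' i, τ i) * ‖x‖ * ‖y‖ := by
    intro x y
    have h0 : 0 ≤ ∑' i, τ i := tsum_nonneg hτ
    calc ‖B x y‖ ≤ ∑' p : ι × ι, r x p.1 * r y p.2 :=
          tsum_of_norm_bounded (hrr x y).hasSum (hle x y)
      _ = (∑' i, r x i) * ∑' i, r y i :=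
          ((hrs x).1.tsum_mul_tsum (hrs y).1 (hrr x y)).symm
      _ ≤ (‖x‖ * √(∑' i, τ i)) * (‖y‖ * √(∑' i, τ i)) := by
          gcongr
          · exact (hrs x).2
          · exact (hrs y).2
      _ = √(∑' i, τ i) * √(∑' i, τ i) * ‖x‖ * ‖y‖ := by ring
      _ = _ := by rw [Real.mul_self_sqrt h0]
  -- The operator representing the form acts in the first slot of the inner product; the adjoint
  -- moves it to the second.
  refine ⟨(InnerProductSpace.continuousLinearMapOfBilin (B.mkContinuous₂ _ hB)).adjoint,
    fun x y => ?_⟩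
  rw [ContinuousLinearMap.adjoint_inner_right, InnerProductSpace.continuousLinearMapOfBilin_apply]
  exact (hsum x y).hasSum

/-! ### Cauchy–Schwarz inequality and summability for the densities -/

namespace Distribution

variable {S : Distribution H} {ρ : Measure ℝ}

lemma inner_opMeasure_comm (S : Distribution H) {Δ : Set ℝ} (hm : MeasurableSet Δ)
    (hb : Bornology.IsBounded Δ) (x y : H) :
    (starRingEnd ℂ) ⟪x, S.opMeasure Δ y⟫_ℂ = ⟪y, S.opMeasure Δ x⟫_ℂ := by
  have h : LinearMap.IsSymmetric (S.opMeasure Δ : H →ₗ[ℂ] H) := by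
    rw [LinearMap.isSymmetric_iff_inner_map_self_real]
    intro v
    have := S.inner_opMeasure hm hb v
    rw [inner_conj_symm]
    change ⟪v, S.opMeasure Δ v⟫_ℂ = ⟪S.opMeasure Δ v, v⟫_ℂ
    rw [← inner_conj_symm (S.opMeasure Δ v) v, this, Complex.conj_ofReal]
  rw [inner_conj_symm]
  exact h y x

lemma density_nonneg (S : Distribution H) (ρ : Measure ℝ) (v : H) (t : ℝ) : 0 ≤ S.density ρ v t :=
  ENNReal.toReal_nonneg

lemma integrableOn_density (v : H) {Δ : Set ℝ} (hb : Bornology.IsBounded Δ) :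
    IntegrableOn (S.density ρ v) Δ ρ :=
  Measure.integrableOn_toReal_rnDeriv (S.scalarMeasure_ne_top _ hb)

variable [SigmaFinite ρ]

lemma setIntegral_density (hρ : S.Equivalent ρ) (v : H) (Δ : Set ℝ) :
    ∫ t in Δ, S.density ρ v t ∂ρ = (S.scalarMeasure v).real Δ :=
  Measure.setIntegral_toReal_rnDeriv (hρ.absolutelyContinuous _) _

lemma ae_eq_density (hρ : S.Equivalent ρ) (v : H) {f : ℝ → ℂ}
    (hf : ∀ Δ, MeasurableSet Δ → Bornology.IsBounded Δ → IntegrableOn f Δ ρ)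
    (h : ∀ Δ, MeasurableSet Δ → Bornology.IsBounded Δ →
      ∫ t in Δ, f t ∂ρ = ⟪v, S.opMeasure Δ v⟫_ℂ) :
    f =ᵐ[ρ] fun t => (S.density ρ v t : ℂ) := by
  refine ae_eq_of_setIntegral_eq_of_isBounded hf
    (fun Δ _ hb => (integrableOn_density v hb).ofReal) fun Δ hm hb => ?_
  rw [h Δ hm hb, integral_complex_ofReal, setIntegral_density hρ, S.inner_opMeasure hm hb]

/-- The Cauchy-Schwarz inequality for the densities. -/
lemma ae_norm_polarDensity_le (hρ : S.Equivalent ρ) (u v : H) :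
    ∀ᵐ t ∂ρ, ‖S.polarDensity ρ u v t‖ ≤ √(S.density ρ u t) * √(S.density ρ v t) := by
  -- For a fixed `c` this expression is, almost everywhere, the density of the scalar measure of `c
  -- • u - v`, hence nonnegative.
  have key : ∀ c : ℂ, ∀ᵐ t ∂ρ, 0 ≤ ‖c‖ ^ 2 * S.density ρ u t
      - 2 * ((starRingEnd ℂ) c * S.polarDensity ρ u v t).re + S.density ρ v t := by
    intro c
    set f : ℝ → ℂ := fun t => ((‖c‖ ^ 2 * S.density ρ u t : ℝ) : ℂ)
      - ((starRingEnd ℂ) c * S.polarDensity ρ u v t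
        + c * (starRingEnd ℂ) (S.polarDensity ρ u v t)) + (S.density ρ v t : ℂ) with hf
    have i1 : ∀ Δ, Bornology.IsBounded Δ →
        IntegrableOn (fun t => ((‖c‖ ^ 2 * S.density ρ u t : ℝ) : ℂ)) Δ ρ :=
      fun Δ hb => ((integrableOn_density u hb).const_mul _).ofReal
    have i2 : ∀ Δ, Bornology.IsBounded Δ →
        IntegrableOn (fun t => (starRingEnd ℂ) c * S.polarDensity ρ u v t) Δ ρ :=
      fun Δ hb => (integrableOn_polarDensity u v hb).const_mul _
    have i3 : ∀ Δ, Bornology.IsBounded Δ →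
        IntegrableOn (fun t => c * (starRingEnd ℂ) (S.polarDensity ρ u v t)) Δ ρ :=
      fun Δ hb => (Complex.conjCLE.toContinuousLinearMap.integrable_comp
        (integrableOn_polarDensity u v hb)).const_mul c
    have i4 : ∀ Δ, Bornology.IsBounded Δ →
        IntegrableOn (fun t => (S.density ρ v t : ℂ)) Δ ρ :=
      fun Δ hb => (integrableOn_density v hb).ofReal
    have i23 : ∀ Δ, Bornology.IsBounded Δ →
        IntegrableOn (fun t => (starRingEnd ℂ) c * S.polarDensity ρ u v t
          + c * (starRingEnd ℂ) (S.polarDensity ρ u v t)) Δ ρ :=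
      fun Δ hb => (i2 Δ hb).add (i3 Δ hb)
    have i123 : ∀ Δ, Bornology.IsBounded Δ →
        IntegrableOn (fun t => ((‖c‖ ^ 2 * S.density ρ u t : ℝ) : ℂ)
          - ((starRingEnd ℂ) c * S.polarDensity ρ u v t
            + c * (starRingEnd ℂ) (S.polarDensity ρ u v t))) Δ ρ :=
      fun Δ hb => (i1 Δ hb).sub (i23 Δ hb)
    have hfe := ae_eq_density hρ (c • u - v) (f := f)
      (fun Δ _ hb => (i123 Δ hb).add (i4 Δ hb)) fun Δ hm hb => by
        simp only [hf]
        rw [integral_add (i123 Δ hb) (i4 Δ hb),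
          integral_sub (i1 Δ hb) (i23 Δ hb), integral_add (i2 Δ hb) (i3 Δ hb),
          integral_complex_ofReal, integral_complex_ofReal, integral_const_mul,
          integral_const_mul, integral_const_mul, integral_conj, setIntegral_density hρ,
          setIntegral_density hρ, setIntegral_polarDensity hρ _ _ hm hb,
          S.inner_opMeasure_comm hm hb, Complex.ofReal_mul, ← S.inner_opMeasure hm hb,
          ← S.inner_opMeasure hm hb]
        simp only [map_sub, map_smul, inner_sub_left, inner_sub_right, inner_smul_left,
          inner_smul_right]
        have : ((‖c‖ ^ 2 : ℝ) : ℂ) = (starRingEnd ℂ) c * c := by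
          rw [Complex.conj_mul']; simp
        rw [this]
        ring
    filter_upwards [hfe] with t ht
    have h1 : (f t).re = S.density ρ (c • u - v) t := by rw [ht, Complex.ofReal_re]
    have h2 := S.density_nonneg ρ (c • u - v) t
    rw [← h1] at h2
    simp only [hf, Complex.add_re, Complex.sub_re, Complex.ofReal_re] at h2
    have h3 : (c * (starRingEnd ℂ) (S.polarDensity ρ u v t)).re
        = ((starRingEnd ℂ) c * S.polarDensity ρ u v t).re := by
      simp
    rw [h3] at h2
    linarith
  -- The null set depends on `c`; a countable dense set of values gives a common one, and continuity
  -- in `c` then recovers all `c`.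
  have key' := ae_all_iff.2 fun n => key (TopologicalSpace.denseSeq ℂ n)
  filter_upwards [key'] with t ht
  set α := S.density ρ u t
  set β := S.polarDensity ρ u v t
  set γ := S.density ρ v t
  have hα : 0 ≤ α := S.density_nonneg ρ u t
  have hγ : 0 ≤ γ := S.density_nonneg ρ v t
  have hall : ∀ c : ℂ, 0 ≤ ‖c‖ ^ 2 * α - 2 * ((starRingEnd ℂ) c * β).re + γ := by
    refine fun c => (TopologicalSpace.denseRange_denseSeq ℂ).induction_on c ?_ ht
    refine isClosed_le continuous_const ?_
    exact ((by fun_prop : Continuous fun c : ℂ => ‖c‖ ^ 2 * α).sub (continuous_const.mul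
      (Complex.continuous_re.comp (Complex.continuous_conj.mul continuous_const)))).add
      continuous_const
  -- With `c = s β`, `s` real, the expression is a nonnegative quadratic polynomial in `s`. Its
  -- discriminant gives `‖β‖⁴ ≤ ‖β‖² α γ`, which yields the claim after division by `‖β‖²` if `β ≠
  -- 0`.
  have hd := discrim_le_zero (a := ‖β‖ ^ 2 * α) (b := -2 * ‖β‖ ^ 2) (c := γ) fun s => by
    have := hall (s * β)
    have e : ((starRingEnd ℂ) (s * β) * β).re = s * ‖β‖ ^ 2 := by
      rw [map_mul, mul_assoc, Complex.conj_mul', Complex.conj_ofReal]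
      norm_cast
    rw [e, norm_mul, Complex.norm_real, mul_pow, Real.norm_eq_abs, sq_abs] at this
    linarith
  rw [discrim] at hd
  rw [← Real.sqrt_mul hα]
  refine Real.le_sqrt_of_sq_le ?_
  rcases (norm_nonneg β).eq_or_lt with h0 | h0
  · rw [← h0]
    simpa using mul_nonneg hα hγ
  · have : 0 < ‖β‖ ^ 2 := by positivity
    by_contra hcon
    rw [not_le] at hcon
    nlinarith [mul_pos this (sub_pos.2 hcon)]

/-- By monotone convergence, the sum of the densities has over a bounded interval `Δ` an integral at
most `‖Σ(Δ)‖ ∑ ‖vᵢ‖² < ∞`, so it is finite almost everywhere. Used with `vᵢ = T bᵢ`, where the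
hypothesis is the Hilbert–Schmidt condition. -/
lemma ae_summable_density (hρ : S.Equivalent ρ) {ι : Type*} [Countable ι] (v : ι → H)
    (hv : Summable fun i => ‖v i‖ ^ 2) : ∀ᵐ t ∂ρ, Summable fun i => S.density ρ (v i) t := by
  refine ae_of_forall_ae_restrict_Ioo fun n => ?_
  set Δ := Ioo (-(n : ℝ)) n
  have hb : Bornology.IsBounded Δ := Metric.isBounded_Ioo _ _
  have hs : Summable fun i => (S.scalarMeasure (v i)).real Δ :=
    Summable.of_nonneg_of_le (fun _ => measureReal_nonneg)
      (fun i => S.scalarMeasure_real_le measurableSet_Ioo hb (v i)) (hv.mul_left _)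
  have hfin : ∫⁻ t in Δ, ∑' i, ENNReal.ofReal (S.density ρ (v i) t) ∂ρ ≠ ∞ := by
    rw [lintegral_tsum fun i => (integrableOn_density (v i) hb).1.aemeasurable.ennreal_ofReal]
    have : ∀ i, ∫⁻ t in Δ, ENNReal.ofReal (S.density ρ (v i) t) ∂ρ
        = ENNReal.ofReal ((S.scalarMeasure (v i)).real Δ) := fun i => by
      rw [← ofReal_integral_eq_lintegral_ofReal (integrableOn_density (v i) hb)
        (ae_of_all _ (S.density_nonneg ρ (v i))), setIntegral_density hρ]
    simp_rw [this]
    exact hs.tsum_ofReal_lt_top.ne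
  have hm : AEMeasurable (fun t => ∑' i, ENNReal.ofReal (S.density ρ (v i) t)) (ρ.restrict Δ) :=
    AEMeasurable.tsum fun i =>
      (integrableOn_density (v i) hb).1.aemeasurable.ennreal_ofReal
  filter_upwards [ae_lt_top' hm hfin] with t ht
  refine (ENNReal.summable_toReal ht.ne).congr fun i => ?_
  rw [ENNReal.toReal_ofReal (S.density_nonneg ρ _ t)]

end Distribution

/-! ### Existence, uniqueness and trace class property of the density -/

/-- Injectivity makes every term of the sum nonzero, and a summable family has countable support.
Countability allows the null sets of the matrix entries to be united. -/
lemma countable_of_summable_norm_sq {H : Type*} [NormedAddCommGroup H]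
    [InnerProductSpace ℂ H] {T : H →L[ℂ] H} {w : Set H} (b : HilbertBasis w ℂ H)
    (hT : LinearMap.ker (T : H →ₗ[ℂ] H) = ⊥) (hb : Summable fun i => ‖T (b i)‖ ^ 2) :
    Countable w := by
  have h : Function.support (fun i => ‖T (b i)‖ ^ 2) = univ := by
    refine eq_univ_of_forall fun i => ?_
    have h1 : b i ≠ 0 := b.orthonormal.ne_zero i
    have h2 : T (b i) ≠ 0 := fun h0 => h1 (LinearMap.ker_eq_bot'.1 hT _ h0)
    simpa using h2
  exact countable_univ_iff.1 (h ▸ hb.countable_support)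

/-- Reduces positivity to countably many conditions, which can hold simultaneously almost
everywhere. On a complex space a real quadratic form already forces selfadjointness. -/
lemma nonneg_of_forall_denseSeq {H : Type*} [NormedAddCommGroup H] [InnerProductSpace ℂ H]
    [TopologicalSpace.SeparableSpace H] (A : H →L[ℂ] H)
    (h : ∀ n, (⟪TopologicalSpace.denseSeq H n, A (TopologicalSpace.denseSeq H n)⟫_ℂ).im = 0 ∧
      0 ≤ (⟪TopologicalSpace.denseSeq H n, A (TopologicalSpace.denseSeq H n)⟫_ℂ).re) :
    0 ≤ A := by
  have h' : ∀ x, (⟪x, A x⟫_ℂ).im = 0 ∧ 0 ≤ (⟪x, A x⟫_ℂ).re := by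
    refine fun x => (TopologicalSpace.denseRange_denseSeq H).induction_on x ?_ h
    have hc : Continuous fun x => ⟪x, A x⟫_ℂ := by fun_prop
    exact (isClosed_eq (Complex.continuous_im.comp hc) continuous_const).inter
      (isClosed_le continuous_const (Complex.continuous_re.comp hc))
  rw [ContinuousLinearMap.nonneg_iff_isPositive, ContinuousLinearMap.isPositive_iff_complex]
  intro x
  have hre : (⟪A x, x⟫_ℂ).re = (⟪x, A x⟫_ℂ).re := by
    rw [← inner_conj_symm (A x) x]
    exact Complex.conj_re _
  have him : (⟪A x, x⟫_ℂ).im = 0 := by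
    rw [← inner_conj_symm (A x) x, Complex.conj_im, (h' x).1, neg_zero]
  refine ⟨Complex.ext (Complex.ofReal_re _) ?_, ?_⟩
  · rw [him]
    exact Complex.ofReal_im _
  · exact (h' x).2.trans_eq hre.symm

section Density

variable {S : Distribution H} {T : H →L[ℂ] H} {ρ : Measure ℝ} {Ψ Ψ' : ℝ → H →L[ℂ] H}

/-- The existence of the density of `T*ΣT`. -/
lemma exists_isBGKDensity [TopologicalSpace.SeparableSpace H] [SigmaFinite ρ]
    (hρ : S.Equivalent ρ) (hHS : IsHilbertSchmidt T)
    (hT : LinearMap.ker (T : H →ₗ[ℂ] H) = ⊥) : ∃ Ψ, IsBGKDensity S T ρ Ψ := by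
  obtain ⟨w, b, hb⟩ := hHS
  have hw : Countable w := countable_of_summable_norm_sq b hT hb
  set a : w → w → ℝ → ℂ := fun i j => S.polarDensity ρ (T (b i)) (T (b j)) with ha
  set τ : w → ℝ → ℝ := fun i => S.density ρ (T (b i)) with hτ
  have hτ0 : ∀ i t, 0 ≤ τ i t := fun i t => S.density_nonneg ρ _ t
  have hsum : ∀ᵐ t ∂ρ, Summable fun i => τ i t := Distribution.ae_summable_density hρ _ hb
  have hle : ∀ᵐ t ∂ρ, ∀ i j, ‖a i j t‖ ≤ √(τ i t) * √(τ j t) :=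
    ae_all_iff.2 fun i => ae_all_iff.2 fun j => Distribution.ae_norm_polarDensity_le hρ _ _
  -- Stated as an implication so that an operator can be chosen at every `t`; on the null set where
  -- the bounds fail it is `0`.
  have hex : ∀ t, ∃ A : H →L[ℂ] H, (Summable fun i => τ i t) →
      (∀ i j, ‖a i j t‖ ≤ √(τ i t) * √(τ j t)) → ∀ x y,
      HasSum (fun p : w × w => ⟪x, b p.1⟫_ℂ * a p.1 p.2 t * ⟪b p.2, y⟫_ℂ) ⟪x, A y⟫_ℂ := by
    intro t
    by_cases h : (Summable fun i => τ i t) ∧ ∀ i j, ‖a i j t‖ ≤ √(τ i t) * √(τ j t)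
    · obtain ⟨A, hA⟩ := exists_hasSum_inner_apply b (fun i j => a i j t) (fun i => τ i t)
        (fun i => hτ0 i t) h.1 h.2
      exact ⟨A, fun _ _ => hA⟩
    · exact ⟨0, fun h1 h2 => absurd ⟨h1, h2⟩ h⟩
  choose Ψ hΨ using hex
  have key : ∀ Δ, MeasurableSet Δ → Bornology.IsBounded Δ → ∀ x y,
      IntegrableOn (fun t => ⟪x, Ψ t y⟫_ℂ) Δ ρ ∧
      ⟪x, (T.adjoint ∘L S.opMeasure Δ ∘L T) y⟫_ℂ = ∫ t in Δ, ⟪x, Ψ t y⟫_ℂ ∂ρ := by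
    intro Δ hm hbd x y
    have hi : ∀ p : w × w,
        IntegrableOn (fun t => ⟪x, b p.1⟫_ℂ * a p.1 p.2 t * ⟪b p.2, y⟫_ℂ) Δ ρ := fun p =>
      ((Distribution.integrableOn_polarDensity _ _ hbd).const_mul _).mul_const _
    have hτi : ∀ i, IntegrableOn (τ i) Δ ρ := fun i => Distribution.integrableOn_density _ hbd
    set m : w → ℝ := fun i => ∫ t in Δ, τ i t ∂ρ with hm_def
    have hm0 : ∀ i, 0 ≤ m i := fun i => integral_nonneg (hτ0 i)
    have hms : Summable m := by
      refine Summable.of_nonneg_of_le hm0 (fun i => ?_) (hb.mul_left ‖S.opMeasure Δ‖)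
      simp only [hm_def, hτ, Distribution.setIntegral_density hρ]
      exact S.scalarMeasure_real_le hm hbd _
    have hbes : ∀ z, Summable fun i => ‖⟪b i, z⟫_ℂ‖ ^ 2 := fun z =>
      b.orthonormal.inner_products_summable z
    -- By `X √τⱼ √τᵢ Y ≤ X² τⱼ + τᵢ Y²`, the double sum is dominated by products of a Bessel series
    -- and the series of the integrals of the `τᵢ`.
    have hs : Summable fun p : w × w =>
        ∫ t in Δ, ‖⟪x, b p.1⟫_ℂ * a p.1 p.2 t * ⟪b p.2, y⟫_ℂ‖ ∂ρ := by
      have h1 : Summable fun p : w × w => ‖⟪b p.1, x⟫_ℂ‖ ^ 2 * m p.2 :=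
        (hbes x).mul_of_nonneg hms (fun _ => by positivity) hm0
      have h2 : Summable fun p : w × w => m p.1 * ‖⟪b p.2, y⟫_ℂ‖ ^ 2 :=
        hms.mul_of_nonneg (hbes y) hm0 (fun _ => by positivity)
      refine Summable.of_nonneg_of_le (fun _ => integral_nonneg fun _ => norm_nonneg _)
        (fun p => ?_) (h1.add h2)
      have e : ‖⟪b p.1, x⟫_ℂ‖ ^ 2 * m p.2 + m p.1 * ‖⟪b p.2, y⟫_ℂ‖ ^ 2
          = ∫ t in Δ, (‖⟪b p.1, x⟫_ℂ‖ ^ 2 * τ p.2 t + τ p.1 t * ‖⟪b p.2, y⟫_ℂ‖ ^ 2) ∂ρ := by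
        rw [integral_add ((hτi _).const_mul _) ((hτi _).mul_const _), integral_const_mul,
          integral_mul_const]
      rw [e]
      refine integral_mono_ae (hi p).norm
        (((hτi _).const_mul _).add ((hτi _).mul_const _)) (ae_restrict_of_ae ?_)
      filter_upwards [hle] with t ht
      rw [norm_mul, norm_mul, norm_inner_symm x]
      set X := ‖⟪b p.1, x⟫_ℂ‖
      set Y := ‖⟪b p.2, y⟫_ℂ‖
      have hX : 0 ≤ X := norm_nonneg _
      have hY : 0 ≤ Y := norm_nonneg _
      calc X * ‖a p.1 p.2 t‖ * Y ≤ X * (√(τ p.1 t) * √(τ p.2 t)) * Y := by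
            gcongr
            exact ht _ _
        _ ≤ X ^ 2 * √(τ p.2 t) ^ 2 + √(τ p.1 t) ^ 2 * Y ^ 2 := by
            nlinarith [sq_nonneg (X * √(τ p.2 t) - √(τ p.1 t) * Y),
              sq_nonneg (X * √(τ p.2 t)), sq_nonneg (√(τ p.1 t) * Y)]
        _ = _ := by rw [Real.sq_sqrt (hτ0 _ _), Real.sq_sqrt (hτ0 _ _)]
    have hlim : ∀ᵐ t ∂ρ.restrict Δ,
        HasSum (fun p : w × w => ⟪x, b p.1⟫_ℂ * a p.1 p.2 t * ⟪b p.2, y⟫_ℂ) ⟪x, Ψ t y⟫_ℂ := by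
      refine ae_restrict_of_ae ?_
      filter_upwards [hsum, hle] with t h1 h2
      exact hΨ t h1 h2 x y
    obtain ⟨h1, h2⟩ := integrable_and_hasSum_integral_of_summable_integral_norm hi hs hlim
    refine ⟨h1, ?_⟩
    symm
    refine b.hasSum_inner_mul_apply_mul_inner _ x y (h2.congr_fun fun p => ?_)
    rw [integral_mul_const, integral_const_mul, Distribution.setIntegral_polarDensity hρ _ _ hm hbd]
    simp [ContinuousLinearMap.adjoint_inner_right]
  refine ⟨Ψ, ?_, fun Δ hm hbd x y => (key Δ hm hbd x y).1,
    fun Δ hm hbd x y => (key Δ hm hbd x y).2⟩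
  -- Positivity is read off from the weak density just constructed: `(Ψ(t)x, x)` is the density of
  -- the positive measure `(Σ(·)T x, T x)`.
  have hpos : ∀ x, (fun t => ⟪x, Ψ t x⟫_ℂ) =ᵐ[ρ] fun t => (S.density ρ (T x) t : ℂ) := fun x =>
    Distribution.ae_eq_density hρ (T x) (fun Δ hm hbd => (key Δ hm hbd x x).1) fun Δ hm hbd => by
      rw [← (key Δ hm hbd x x).2]
      simp [ContinuousLinearMap.adjoint_inner_right]
  filter_upwards [ae_all_iff.2 fun n => hpos (TopologicalSpace.denseSeq H n)] with t ht
  refine nonneg_of_forall_denseSeq _ fun n => ?_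
  rw [ht n]
  exact ⟨Complex.ofReal_im _, S.density_nonneg ρ _ t⟩

/-- For each pair `x`, `y` the functions `(Ψ(t)y, x)` and `(Ψ'(t)y, x)` agree almost everywhere.
Pairs from a countable dense set have a common null set, off which continuity gives equality of the
operators. -/
lemma IsBGKDensity.ae_unique [TopologicalSpace.SeparableSpace H] (hΨ : IsBGKDensity S T ρ Ψ)
    (hΨ' : IsBGKDensity S T ρ Ψ') : ∀ᵐ t ∂ρ, Ψ t = Ψ' t := by
  have h : ∀ x y : H, (fun t => ⟪x, Ψ t y⟫_ℂ) =ᵐ[ρ] fun t => ⟪x, Ψ' t y⟫_ℂ := fun x y =>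
    ae_eq_of_setIntegral_eq_of_isBounded (fun Δ hm hb => hΨ.integrableOn Δ hm hb x y)
      (fun Δ hm hb => hΨ'.integrableOn Δ hm hb x y) fun Δ hm hb => by
        rw [← hΨ.setIntegral_eq Δ hm hb, ← hΨ'.setIntegral_eq Δ hm hb]
  filter_upwards [ae_all_iff.2 fun n => ae_all_iff.2 fun m =>
    h (TopologicalSpace.denseSeq H n) (TopologicalSpace.denseSeq H m)] with t ht
  have hd := TopologicalSpace.denseRange_denseSeq H
  refine DFunLike.coe_injective (hd.equalizer (Ψ t).continuous (Ψ' t).continuous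
    (funext fun m => ext_inner_left ℂ fun x => ?_))
  exact congrFun (hd.equalizer (g := fun x => ⟪x, Ψ t (TopologicalSpace.denseSeq H m)⟫_ℂ)
    (h := fun x => ⟪x, Ψ' t (TopologicalSpace.denseSeq H m)⟫_ℂ) (by fun_prop) (by fun_prop)
    (funext fun n => ht n m)) x

/-- As `Ψ(t) ≥ 0`, it equals its own absolute value, and its diagonal entries in the basis `b` are
the densities of `(Σ(·)T bᵢ, T bᵢ)`, summable almost everywhere. -/
lemma IsBGKDensity.ae_isTraceClass [SigmaFinite ρ] (hΨ : IsBGKDensity S T ρ Ψ)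
    (hρ : S.Equivalent ρ) (hHS : IsHilbertSchmidt T)
    (hT : LinearMap.ker (T : H →ₗ[ℂ] H) = ⊥) : ∀ᵐ t ∂ρ, IsTraceClass (Ψ t) := by
  obtain ⟨w, b, hb⟩ := hHS
  have hw : Countable w := countable_of_summable_norm_sq b hT hb
  have h : ∀ i, (fun t => ⟪b i, Ψ t (b i)⟫_ℂ) =ᵐ[ρ] fun t => (S.density ρ (T (b i)) t : ℂ) :=
    fun i => Distribution.ae_eq_density hρ (T (b i))
      (fun Δ hm hbd => hΨ.integrableOn Δ hm hbd _ _) fun Δ hm hbd => by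
        rw [← hΨ.setIntegral_eq Δ hm hbd]
        simp [ContinuousLinearMap.adjoint_inner_right]
  filter_upwards [hΨ.nonneg, Distribution.ae_summable_density hρ _ hb, ae_all_iff.2 h]
    with t h0 hs ht
  refine ⟨w, b, ?_⟩
  rw [CFC.abs_of_nonneg (Ψ t) h0]
  refine hs.congr fun i => ?_
  rw [ht i, Complex.ofReal_re]

end Density

/-! ### Density in `L₂(Σ, H)` of the functions with values in `ran T` -/

namespace Distribution

variable (S : Distribution H)

/-- The class map `C₀₀(H) → L₂(Σ, H)`, as a linear map. -/
def toL2ₗ : C00 H →ₗ[ℂ] S.L2 :=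
  (UniformSpace.Completion.toComplₗᵢ (𝕜 := ℂ) (E := S.PreL2)).toLinearMap ∘ₗ
    S.toPreL2.toLinearMap

lemma toL2ₗ_apply (f : C00 H) : S.toL2ₗ f = S.toL2 f := rfl

lemma denseRange_toL2 : DenseRange S.toL2 :=
  UniformSpace.Completion.denseRange_coe.comp S.toPreL2.surjective.denseRange
    (UniformSpace.Completion.continuous_coe _)

variable {S} {ρ : Measure ℝ} [SigmaFinite ρ]

/-- With `Δ` the support of `φ` and `M` a bound of `‖φ‖`, the squared norm is at most `M² (Σ(Δ)v,
v)`. Thus `v ↦ φ v` is continuous into `L₂(Σ, H)`, which carries density of `ran T` in `H` over to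
`L₂(Σ, H)`. -/
lemma exists_norm_toL2_single_le (hρ : S.Equivalent ρ) {φ : ℝ → ℂ} (hφ : Continuous φ)
    (hs : HasCompactSupport φ) :
    ∃ C, ∀ v, ‖S.toL2 (C00.single φ hφ hs v)‖ ≤ C * ‖v‖ := by
  obtain ⟨M, hM⟩ := hs.exists_bound_of_continuous hφ
  have hK : IsCompact (tsupport φ) := hs
  set Δ := tsupport φ
  have hm : MeasurableSet Δ := hK.measurableSet
  have hb : Bornology.IsBounded Δ := hK.isBounded
  refine ⟨√(M ^ 2 * ‖S.opMeasure Δ‖), fun v => ?_⟩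
  have h1 : S.polarDensity ρ v v =ᵐ[ρ] fun t => (S.density ρ v t : ℂ) :=
    ae_eq_density hρ v (fun _ _ hb => integrableOn_polarDensity v v hb)
      fun _ hm hb => setIntegral_polarDensity hρ v v hm hb
  have h2 : ⟪S.toL2 (C00.single φ hφ hs v), S.toL2 (C00.single φ hφ hs v)⟫_ℂ
      = ((∫ t in Δ, ‖φ t‖ ^ 2 * S.density ρ v t ∂ρ : ℝ) : ℂ) := by
    rw [inner_toL2, form_single hρ, ← integral_complex_ofReal,
      setIntegral_eq_integral_of_forall_compl_eq_zero]
    · refine integral_congr_ae (h1.mono fun t ht => ?_)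
      simp only [ht, Complex.conj_mul']
      push_cast
      rfl
    · intro t ht
      simp [image_eq_zero_of_notMem_tsupport ht]
  rw [inner_self_eq_norm_sq_to_K] at h2
  have h3 : ‖S.toL2 (C00.single φ hφ hs v)‖ ^ 2 = ∫ t in Δ, ‖φ t‖ ^ 2 * S.density ρ v t ∂ρ :=
    Complex.ofReal_injective (by simpa using h2)
  have h4 : ∫ t in Δ, ‖φ t‖ ^ 2 * S.density ρ v t ∂ρ ≤ ∫ t in Δ, M ^ 2 * S.density ρ v t ∂ρ := by
    refine integral_mono_of_nonneg
      (ae_of_all _ fun t => mul_nonneg (by positivity) (S.density_nonneg ρ v t))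
      ((integrableOn_density v hb).const_mul _) (ae_of_all _ fun t => ?_)
    have := hM t
    have := S.density_nonneg ρ v t
    simp only
    gcongr
  rw [integral_const_mul, setIntegral_density hρ, ← h3] at h4
  have h5 : ‖S.toL2 (C00.single φ hφ hs v)‖ ^ 2 ≤ M ^ 2 * ‖S.opMeasure Δ‖ * ‖v‖ ^ 2 := by
    rw [mul_assoc]
    exact h4.trans (by gcongr; exact S.scalarMeasure_real_le hm hb v)
  calc ‖S.toL2 (C00.single φ hφ hs v)‖ ≤ √(M ^ 2 * ‖S.opMeasure Δ‖ * ‖v‖ ^ 2) :=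
        Real.le_sqrt_of_sq_le h5
    _ = _ := by rw [Real.sqrt_mul (by positivity), Real.sqrt_sq (norm_nonneg v)]

/-- The functions of `C₀₀(H)` of the form `t ↦ T g(t)` are dense in `L₂(Σ, H)` if the range of `T`
is dense. -/
lemma denseRange_toL2_map (hρ : S.Equivalent ρ) {T : H →L[ℂ] H} (hT : DenseRange T) :
    DenseRange (S.toL2ₗ ∘ₗ C00.map T) := by
  set K : Submodule ℂ S.L2 := (S.toL2ₗ ∘ₗ C00.map T).range.topologicalClosure with hK
  have hsingle : ∀ (φ : ℝ → ℂ) (hφ : Continuous φ) (hs : HasCompactSupport φ) (u : H),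
      S.toL2ₗ (C00.single φ hφ hs u) ∈ K := by
    intro φ hφ hs u
    obtain ⟨C, hC⟩ := exists_norm_toL2_single_le (S := S) hρ hφ hs
    let G : H →ₗ[ℂ] S.L2 := S.toL2ₗ ∘ₗ
      { toFun := C00.single φ hφ hs
        map_add' := fun u v => Subtype.ext (funext fun t => smul_add (φ t) u v)
        map_smul' := fun c u => Subtype.ext (funext fun t => smul_comm (φ t) c u) }
    have hG : Continuous G := AddMonoidHomClass.continuous_of_bound G C hC
    -- The condition is closed in `u` because `G` is continuous, so it suffices to check `u = T x`.
    refine hT.induction_on (p := fun u => G u ∈ K) u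
      ((Submodule.isClosed_topologicalClosure _).preimage hG) fun x => ?_
    refine Submodule.le_topologicalClosure _ ⟨C00.single φ hφ hs x, ?_⟩
    rw [LinearMap.comp_apply, C00.map_single]
    rfl
  have hall : ∀ f : C00 H, S.toL2 f ∈ K := by
    intro f
    obtain ⟨n, φ, hφ, hs, u, rfl⟩ := C00.exists_eq_sum_single f
    rw [← toL2ₗ_apply, map_sum]
    exact Submodule.sum_mem _ fun i _ => hsingle _ _ _ _
  have : (K : Set S.L2) = univ := by
    refine (IsClosed.closure_eq (Submodule.isClosed_topologicalClosure _)).symm.trans ?_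
    refine (S.denseRange_toL2.mono ?_).closure_eq
    rintro _ ⟨f, rfl⟩
    exact hall f
  rw [hK, Submodule.topologicalClosure_coe] at this
  exact dense_iff_closure_eq.2 this

lemma dense_image_toL2 {T : H →L[ℂ] H} (hρ : S.Equivalent ρ) (hd : DenseRange T) :
    Dense (S.toL2 '' {f : C00 H | ∀ t, f.1 t ∈ dom T}) := by
  refine (denseRange_toL2_map hρ hd).mono ?_
  rintro _ ⟨g, rfl⟩
  exact ⟨C00.map T g, fun t => LinearMap.mem_range_self _ _, rfl⟩

end Distribution

lemma denseRange_of_ker_adjoint_eq_bot {T : H →L[ℂ] H}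
    (hT : LinearMap.ker (T.adjoint : H →ₗ[ℂ] H) = ⊥) : DenseRange T := by
  have h : (LinearMap.range (T : H →ₗ[ℂ] H)).topologicalClosure = ⊤ := by
    rw [Submodule.topologicalClosure_eq_top_iff]
    exact (ContinuousLinearMap.orthogonal_range T).trans hT
  have := (Submodule.dense_iff_topologicalClosure_eq_top).2 h
  exact this

/-! ### Sections of the form `t ↦ T g(t)` -/

section Fibre

variable (T : H →L[ℂ] H) (hT : LinearMap.ker (T : H →ₗ[ℂ] H) = ⊥) (A : H →L[ℂ] H)

/-- The canonical map of `D(T⁻¹)` to the fibre, as a linear map. -/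
def toFibreₗ : dom T →ₗ[ℂ] Fibre T hT A :=
  (UniformSpace.Completion.toComplₗᵢ (𝕜 := ℂ) (E := PreFibre T hT A)).toLinearMap ∘ₗ
    (toPreFibre T hT A).toLinearMap

lemma norm_toFibre (h : dom T) : ‖toFibre T hT A h‖ = ‖CFC.sqrt A (inv T hT h)‖ :=
  (UniformSpace.Completion.norm_coe _).trans (norm_toPreFibre T hT A h)

lemma inner_toFibre_apply (hA : 0 ≤ A) (x y : H) (hx : T x ∈ dom T) (hy : T y ∈ dom T) :
    ⟪toFibre T hT A ⟨T x, hx⟩, toFibre T hT A ⟨T y, hy⟩⟫_ℂ = ⟪x, A y⟫_ℂ := by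
  rw [inner_toFibre, inner_weight T hT A hA, inv_apply, inv_apply]

end Fibre

section BGK

variable [TopologicalSpace.SeparableSpace H] {S : Distribution H} {T : H →L[ℂ] H}
  (hT : LinearMap.ker (T : H →ₗ[ℂ] H) = ⊥) {ρ : Measure ℝ} {Ψ : ℝ → H →L[ℂ] H}

lemma isMeasurableSection_toFibre_map (hΨ : IsBGKDensity S T ρ Ψ) (g : C00 H) :
    (bgkField hT hΨ).IsMeasurableSection
      (fun t => toFibre T hT (Ψ t) ⟨T (g.1 t), LinearMap.mem_range_self _ _⟩) := by
  rintro ⟨_, x, rfl⟩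
  have h : AEStronglyMeasurable (fun t => ⟪x, Ψ t (g.1 t)⟫_ℂ) ρ := by
    obtain ⟨n, φ, hφ, hφs, u, rfl⟩ := C00.exists_eq_sum_single g
    have : ∀ t, ⟪x, Ψ t ((∑ i, C00.single (φ i) (hφ i) (hφs i) (u i) : C00 H).1 t)⟫_ℂ
        = ∑ i, φ i t * ⟪x, Ψ t (u i)⟫_ℂ := fun t => by
      simp only [Submodule.coe_sum, Finset.sum_apply, C00.single, map_sum, map_smul, inner_sum,
        inner_smul_right]
    simp_rw [this]
    exact Finset.aestronglyMeasurable_fun_sum _ fun i _ =>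
      (hφ i).aestronglyMeasurable.mul (hΨ.aestronglyMeasurable x (u i))
  refine h.congr ?_
  filter_upwards [hΨ.nonneg] with t ht
  exact (inner_toFibre_apply T hT _ ht _ _ _ _).symm

lemma toFibre_map_mem_sqIntegrable (hΨ : IsBGKDensity S T ρ Ψ) (g : C00 H) :
    (fun t => toFibre T hT (Ψ t) ⟨T (g.1 t), LinearMap.mem_range_self _ _⟩)
      ∈ (bgkField hT hΨ).sqIntegrable := by
  have hm := isMeasurableSection_toFibre_map hT hΨ g
  refine ⟨hm, (memLp_two_iff_integrable_sq hm.norm).2 ?_⟩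
  refine (hΨ.integrable_inner_apply g g).re.congr ?_
  filter_upwards [hΨ.nonneg] with t ht
  rw [← inner_toFibre_apply T hT _ ht _ _ (LinearMap.mem_range_self _ _)
    (LinearMap.mem_range_self _ _)]
  exact inner_self_eq_norm_sq _

/-- The section `t ↦ T g(t)`, for `g` in `C₀₀(H)`. -/
def mapSection (hΨ : IsBGKDensity S T ρ Ψ) : C00 H →ₗ[ℂ] (bgkField hT hΨ).sqIntegrable where
  toFun g := ⟨_, toFibre_map_mem_sqIntegrable hT hΨ g⟩
  map_add' g g' := Subtype.ext (funext fun t => by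
    change toFibreₗ T hT (Ψ t) _ = toFibreₗ T hT (Ψ t) _ + toFibreₗ T hT (Ψ t) _
    rw [← map_add]
    congr 1
    exact Subtype.ext (map_add T (g.1 t) (g'.1 t)))
  map_smul' c g := Subtype.ext (funext fun t => by
    change toFibreₗ T hT (Ψ t) _ = c • toFibreₗ T hT (Ψ t) _
    rw [← map_smul]
    congr 1
    exact Subtype.ext (map_smul T c (g.1 t)))

/-- The heart of the identification: both squared norms equal `∫ (Ψ(t)g(t), g(t)) dρ(t)`. -/
lemma norm_toClass_mapSection [SigmaFinite ρ] (hρ : S.Equivalent ρ) (hΨ : IsBGKDensity S T ρ Ψ)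
    (g : C00 H) :
    ‖(bgkField hT hΨ).toClassₗ (mapSection hT hΨ g)‖ = ‖S.toL2 (C00.map T g)‖ := by
  have h : ⟪(bgkField hT hΨ).toClassₗ (mapSection hT hΨ g),
      (bgkField hT hΨ).toClassₗ (mapSection hT hΨ g)⟫_ℂ
      = ⟪S.toL2 (C00.map T g), S.toL2 (C00.map T g)⟫_ℂ := by
    rw [hΨ.inner_toL2_map hρ, MeasurableField.toClassₗ_apply, MeasurableField.inner_toClass]
    refine integral_congr_ae ?_
    filter_upwards [hΨ.nonneg] with t ht
    exact inner_toFibre_apply T hT _ ht _ _ _ _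
  rw [norm_eq_sqrt_re_inner (𝕜 := ℂ), h, ← norm_eq_sqrt_re_inner]

/-- The squared fibre norm of `T x` is `(Ψ(t)x, x)`, integrable over bounded sets by the definition
of a density. So the constant section is locally square-integrable even where `ρ` is not locally
finite, and its product with the norm of `s` is locally integrable. -/
lemma locallyIntegrable_inner_toFibre (hΨ : IsBGKDensity S T ρ Ψ) (x : H)
    (s : (bgkField hT hΨ).sqIntegrable) :
    LocallyIntegrable
      (fun t => ⟪toFibre T hT (Ψ t) ⟨T x, LinearMap.mem_range_self _ _⟩, s.1 t⟫_ℂ) ρ := by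
  intro t₀
  refine ⟨Metric.ball t₀ 1, Metric.ball_mem_nhds _ one_pos, ?_⟩
  set e := fun t => toFibre T hT (Ψ t) ⟨T x, LinearMap.mem_range_self _ _⟩
  have he : (bgkField hT hΨ).IsMeasurableSection e := fun i =>
    (bgkField hT hΨ).measurable_inner i _
  have h1 : MemLp (fun t => ‖e t‖) 2 (ρ.restrict (Metric.ball t₀ 1)) := by
    refine (memLp_two_iff_integrable_sq he.norm.restrict).2 ?_
    refine (hΨ.integrableOn _ measurableSet_ball Metric.isBounded_ball x x).re.congr
      (ae_restrict_of_ae ?_)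
    filter_upwards [hΨ.nonneg] with t ht
    rw [← inner_toFibre_apply T hT _ ht _ _ (LinearMap.mem_range_self _ _)
      (LinearMap.mem_range_self _ _)]
    exact inner_self_eq_norm_sq _
  refine (h1.integrable_mul (s.2.2.restrict _)).mono (he.inner s.2.1).restrict
    (ae_of_all _ fun t => ?_)
  simpa using norm_inner_le_norm (𝕜 := ℂ) (e t) (s.1 t)

/-- By completeness it suffices that the orthogonal complement is zero. Orthogonality to the
sections `φ(t) T x` with smooth `φ` gives `(s(t), T x) = 0` almost everywhere for each `x`. For `x`
in a countable dense set of `H` these vectors are dense in every fibre, so `s(t) = 0`. -/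
lemma denseRange_toClass_mapSection (hΨ : IsBGKDensity S T ρ Ψ) :
    DenseRange ((bgkField hT hΨ).toClassₗ ∘ₗ mapSection hT hΨ) := by
  set K := ((bgkField hT hΨ).toClassₗ ∘ₗ mapSection hT hΨ).range
  suffices h : Kᗮ = ⊥ from
    (Submodule.dense_iff_topologicalClosure_eq_top).2
      ((Submodule.topologicalClosure_eq_top_iff).2 h)
  rw [eq_bot_iff]
  intro z hz
  obtain ⟨s, rfl⟩ := (bgkField hT hΨ).toClassₗ_surjective z
  have h0 : ∀ x : H, ∀ᵐ t ∂ρ,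
      ⟪toFibre T hT (Ψ t) ⟨T x, LinearMap.mem_range_self _ _⟩, s.1 t⟫_ℂ = 0 := by
    intro x
    refine ae_eq_zero_of_integral_contDiff_smul_eq_zero
      (locallyIntegrable_inner_toFibre hT hΨ x s) fun φ hφ hφs => ?_
    set g : C00 H := C00.single (fun t => (φ t : ℂ))
      (Complex.continuous_ofReal.comp hφ.continuous) (hφs.comp_left Complex.ofReal_zero) x
    have := hz _ ⟨g, rfl⟩
    rw [LinearMap.comp_apply, MeasurableField.toClassₗ_apply, MeasurableField.toClassₗ_apply,
      MeasurableField.inner_toClass] at this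
    rw [← this]
    refine integral_congr_ae (ae_of_all _ fun t => ?_)
    have e : (mapSection hT hΨ g).1 t
        = (φ t : ℂ) • toFibre T hT (Ψ t) ⟨T x, LinearMap.mem_range_self _ _⟩ := by
      change toFibreₗ T hT (Ψ t) _ = (φ t : ℂ) • toFibreₗ T hT (Ψ t) _
      rw [← map_smul]
      congr 1
      exact Subtype.ext (map_smul T (φ t : ℂ) x)
    simp only [e, inner_smul_left, Complex.conj_ofReal, Complex.real_smul]
  have hs : ∀ᵐ t ∂ρ, s.1 t = (0 : (bgkField hT hΨ).sqIntegrable).1 t := by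
    filter_upwards [ae_all_iff.2 fun n => h0 (TopologicalSpace.denseSeq H n)] with t ht
    have := (denseRange_toFibre T hT (Ψ t)).equalizer
      (g := fun v : Fibre T hT (Ψ t) => ⟪v, s.1 t⟫_ℂ) (h := fun _ => 0) (by fun_prop) (by fun_prop)
      (funext ht)
    exact inner_self_eq_zero.1 (congrFun this (s.1 t))
  have := ((bgkField hT hΨ).toClass_eq_iff _ _ s.2 (Submodule.zero_mem _)).2 hs
  rw [Submodule.mem_bot]
  exact this.trans (map_zero (bgkField hT hΨ).toClassₗ)

lemma IsCanonical.apply_map {hΨ : IsBGKDensity S T ρ Ψ} {U : S.L2 ≃ₗᵢ[ℂ] BGKIntegral hT hΨ}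
    (hU : IsCanonical hT U) (g : C00 H) :
    U (S.toL2 (C00.map T g)) = (bgkField hT hΨ).toClassₗ (mapSection hT hΨ g) := by
  obtain ⟨_, h⟩ := hU (C00.map T g) fun t => LinearMap.mem_range_self _ _
  exact h

/-! ### The canonical isometry -/

variable [SigmaFinite ρ]

/-- The two maps out of `C₀₀(H)` have equal norms and dense ranges in complete spaces, so the
correspondence between their values extends to an isometry onto. Neither map need be injective, as
null vectors go to zero on both sides. Uniqueness holds because the values on a dense set are
prescribed. -/
lemma existsUnique_isCanonical (hρ : S.Equivalent ρ) (hΨ : IsBGKDensity S T ρ Ψ)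
    (hd : DenseRange T) : ∃! U : S.L2 ≃ₗᵢ[ℂ] BGKIntegral hT hΨ, IsCanonical hT U := by
  have hd1 := Distribution.denseRange_toL2_map hρ hd
  have hd2 := denseRange_toClass_mapSection hT hΨ
  have hn : ∀ g, ‖((bgkField hT hΨ).toClassₗ ∘ₗ mapSection hT hΨ) (LinearEquiv.refl ℂ (C00 H) g)‖
      = ‖(S.toL2ₗ ∘ₗ C00.map T) g‖ := norm_toClass_mapSection hT hρ hΨ
  have hU₀ := LinearEquiv.extendOfIsometry_eq (LinearEquiv.refl ℂ (C00 H)) _ _ hd1 hd2 hn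
  refine ⟨(LinearEquiv.refl ℂ (C00 H)).extendOfIsometry _ _ hd1 hd2 hn, ?_, ?_⟩
  · intro f hf
    -- The extension is known only on the functions `T g`; the lifting shows that these are all the
    -- functions with values in `ran T`.
    obtain ⟨g, rfl⟩ := C00.exists_map_eq T hT f hf
    exact ⟨(mapSection hT hΨ g).2, hU₀ g⟩
  · intro U hU
    refine LinearIsometryEquiv.ext fun z => congrFun (hd1.equalizer U.continuous
      (LinearIsometryEquiv.continuous _) (funext fun g => ?_)) z
    exact (hU.apply_map hT g).trans (hU₀ g).symm

lemma norm_sq_toL2_eq_integral (hρ : S.Equivalent ρ) (hΨ : IsBGKDensity S T ρ Ψ) (f : C00 H)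
    (hf : ∀ t, f.1 t ∈ dom T) :
    Integrable (fun t => ‖CFC.sqrt (Ψ t) (inv T hT ⟨f.1 t, hf t⟩)‖ ^ 2) ρ ∧
      ‖S.toL2 f‖ ^ 2 = ∫ t, ‖CFC.sqrt (Ψ t) (inv T hT ⟨f.1 t, hf t⟩)‖ ^ 2 ∂ρ := by
  obtain ⟨g, rfl⟩ := C00.exists_map_eq T hT f hf
  rw [← norm_toClass_mapSection hT hρ hΨ, MeasurableField.norm_sq_toClassₗ]
  simp_rw [← norm_toFibre]
  exact ⟨(mapSection hT hΨ g).2.2.integrable_sq, rfl⟩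

end BGK

end OpMeasure

end

theorem theorem1 {H : Type*} [NormedAddCommGroup H] [InnerProductSpace ℂ H] [CompleteSpace H]
    [TopologicalSpace.SeparableSpace H] (S : OpMeasure.Distribution H)
    (ρ : MeasureTheory.Measure ℝ) [MeasureTheory.SigmaFinite ρ] (hρ : S.Equivalent ρ) :
    (∀ T : H →L[ℂ] H, OpMeasure.IsHilbertSchmidt T →
      ∀ hT : LinearMap.ker (T : H →ₗ[ℂ] H) = ⊥,
      LinearMap.ker (T.adjoint : H →ₗ[ℂ] H) = ⊥ →
      -- existence and uniqueness of the density
      (∃ Ψ, OpMeasure.IsBGKDensity S T ρ Ψ) ∧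
      (∀ Ψ Ψ', OpMeasure.IsBGKDensity S T ρ Ψ → OpMeasure.IsBGKDensity S T ρ Ψ' →
        ∀ᵐ t ∂ρ, Ψ t = Ψ' t) ∧
      ∀ Ψ (hΨ : OpMeasure.IsBGKDensity S T ρ Ψ),
        (∀ᵐ t ∂ρ, OpMeasure.IsTraceClass (Ψ t)) ∧
        -- the canonical isometric identification with the direct integral
        (∃! U : S.L2 ≃ₗᵢ[ℂ] OpMeasure.BGKIntegral hT hΨ, OpMeasure.IsCanonical hT U) ∧
        -- the norm identity on a dense set
        Dense (S.toL2 '' {f : OpMeasure.C00 H | ∀ t, f.1 t ∈ OpMeasure.dom T}) ∧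
        ∀ (f : OpMeasure.C00 H) (hf : ∀ t, f.1 t ∈ OpMeasure.dom T),
          MeasureTheory.Integrable
            (fun t => ‖CFC.sqrt (Ψ t) (OpMeasure.inv T hT ⟨f.1 t, hf t⟩)‖ ^ 2) ρ ∧
          ‖S.toL2 f‖ ^ 2
            = ∫ t, ‖CFC.sqrt (Ψ t) (OpMeasure.inv T hT ⟨f.1 t, hf t⟩)‖ ^ 2 ∂ρ) ∧
    -- independence of the choice of `T`
    (∀ T₁ T₂ : H →L[ℂ] H, OpMeasure.IsHilbertSchmidt T₁ → OpMeasure.IsHilbertSchmidt T₂ →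
      ∀ (hT₁ : LinearMap.ker (T₁ : H →ₗ[ℂ] H) = ⊥) (hT₂ : LinearMap.ker (T₂ : H →ₗ[ℂ] H) = ⊥),
      LinearMap.ker (T₁.adjoint : H →ₗ[ℂ] H) = ⊥ → LinearMap.ker (T₂.adjoint : H →ₗ[ℂ] H) = ⊥ →
      ∀ Ψ₁ Ψ₂ (hΨ₁ : OpMeasure.IsBGKDensity S T₁ ρ Ψ₁) (hΨ₂ : OpMeasure.IsBGKDensity S T₂ ρ Ψ₂),
        ∃ V : OpMeasure.BGKIntegral hT₁ hΨ₁ ≃ₗᵢ[ℂ] OpMeasure.BGKIntegral hT₂ hΨ₂,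
          ∀ U₁ U₂, OpMeasure.IsCanonical hT₁ U₁ → OpMeasure.IsCanonical hT₂ U₂ →
            ∀ x, V (U₁ x) = U₂ x) := by
  refine ⟨fun T hHS hT hT' => ⟨OpMeasure.exists_isBGKDensity hρ hHS hT,
    fun _ _ hΨ hΨ' => hΨ.ae_unique hΨ', fun Ψ hΨ => ?_⟩,
    fun T₁ T₂ _ _ hT₁ hT₂ hT₁' hT₂' Ψ₁ Ψ₂ hΨ₁ hΨ₂ => ?_⟩
  · have hd := OpMeasure.denseRange_of_ker_adjoint_eq_bot hT'
    exact ⟨hΨ.ae_isTraceClass hρ hHS hT, OpMeasure.existsUnique_isCanonical hT hρ hΨ hd,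
      OpMeasure.Distribution.dense_image_toL2 hρ hd,
      OpMeasure.norm_sq_toL2_eq_integral hT hρ hΨ⟩
  · obtain ⟨W₁, -, hW₁⟩ := OpMeasure.existsUnique_isCanonical hT₁ hρ hΨ₁
      (OpMeasure.denseRange_of_ker_adjoint_eq_bot hT₁')
    obtain ⟨W₂, -, hW₂⟩ := OpMeasure.existsUnique_isCanonical hT₂ hρ hΨ₂
      (OpMeasure.denseRange_of_ker_adjoint_eq_bot hT₂')
    -- `V` is built from the constructed isometries, independently of `U₁` and `U₂`; uniqueness
    -- identifies these with `W₁` and `W₂`.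
    refine ⟨W₁.symm.trans W₂, fun U₁ U₂ hU₁ hU₂ x => ?_⟩
    rw [hW₁ U₁ hU₁, hW₂ U₂ hU₂, LinearIsometryEquiv.trans_apply,
      LinearIsometryEquiv.symm_apply_apply]
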